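/- Let $(M,g_1)$ be a smooth Riemannian manifold, let $(N,g_2,J)$ be a Kähler manifold (so $J$ is a smooth field of endomorphisms of $TN$ with $J^2=-I$, $g_2(J\cdot,J\cdot)=g_2$ and $\nabla^N J=0$ for the Levi-Civita connection $\nabla^N$), both of finite dimension and without boundary, and let $g:N\to\mathbb R$ be a smooth function. Let $F:M\to N$ be an anti-invariant Riemannian map, that is, a smooth map of constant rank $\operatorname{rank}F>0$ such that for every $p\in M$ the differential $F_{*p}$ restricts to a linear isometry from $(\ker F_{*p})^\bot$ onto $\operatorname{range}F_{*p}=F_{*p}(T_pM)$ and $J(\operatorname{range}F_{*p})\subset(\operatorname{range}F_{*p})^\bot$. Suppose that $F$ is Clairaut with $\tilde s=e^g$ in the following sense, where $\operatorname{range}F_*$ is regarded locally as a distribution on $N$: every point of $M$ has an open neighbourhood $U$ for which there are an open set $W\subset N$ containing $F(U)$ and a smooth distribution $D\subset TN|_W$ of constant rank such that $D_{F(p)}=\operatorname{range}F_{*p}$ for all $p\in U$, and such that for every geodesic $\beta$ of $N$, defined on an open interval and running in $W$, the function $$t\longmapsto e^{g(\beta(t))}\,\sin\omega(t)$$ is constant.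 Here $\dot\beta(t)=X(t)+V(t)$ with $X(t)\in D_{\beta(t)}$ and $V(t)\in D_{\beta(t)}^{\bot}$, and $\omega(t)$ is the angle between $\dot\beta(t)$ and $V(t)$ (with $\omega(t)=\pi/2$ if $V(t)=0$). Then at least one of the following holds: (i) $\dim(\operatorname{range}F_{*p})=1$ for all $p\in M$; (ii) $g$ is constant along $J(\operatorname{range}F_*)$, that is, $dg_{F(p)}(JF_{*p}X)=0$ for all $p\in M$ and all $X\in T_pM$. -/

import Mathlib

open Set Filter Topology Bundle
open scoped Manifold ContDiff RealInnerProductSpace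

noncomputable section

namespace ClairautMap

/-! Manifolds are modelled on a finite-dimensional real vector space `E` through `𝓘(ℝ, E)` (no
boundary). A Riemannian metric is a `RiemannianBundle` structure on the tangent bundle together with
`IsContMDiffRiemannianBundle` (smooth dependence on the point). -/

section Geodesics

variable {E : Type*} [NormedAddCommGroup E] [NormedSpace ℝ E]
  {N : Type*} [TopologicalSpace N] [ChartedSpace E N] [IsManifold 𝓘(ℝ, E) ∞ N]
  [RiemannianBundle (fun x : N => TangentSpace 𝓘(ℝ, E) x)]

/-- The coefficients `g_y(a, b)` of the metric in the chart around `x₀`: the pull-back of the metric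
under the inverse of the chart, evaluated at the point `y : E` on the coordinate vectors `a, b`. -/
def metricInChart (x₀ : N) (y a b : E) : ℝ :=
  ⟪mfderiv 𝓘(ℝ, E) 𝓘(ℝ, E) (extChartAt 𝓘(ℝ, E) x₀).symm y a,
    mfderiv 𝓘(ℝ, E) 𝓘(ℝ, E) (extChartAt 𝓘(ℝ, E) x₀).symm y b⟫

/-- The Christoffel symbols of the first kind in the chart around `x₀`,
`[ab, c] = (∂_a g(b, c) + ∂_b g(a, c) - ∂_c g(a, b)) / 2 = g(∇_a b, c)`. -/
def christoffelFirst (x₀ : N) (y a b c : E) : ℝ :=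
  (fderiv ℝ (fun z => metricInChart x₀ z b c) y a
    + fderiv ℝ (fun z => metricInChart x₀ z a c) y b
    - fderiv ℝ (fun z => metricInChart x₀ z a b) y c) / 2

/-- The velocity `β'(t)` of a curve. -/
def velocity (β : ℝ → N) (t : ℝ) : TangentSpace 𝓘(ℝ, E) (β t) :=
  mfderiv 𝓘(ℝ, ℝ) 𝓘(ℝ, E) β t (1 : ℝ)

/-- `β` is a geodesic on the open set `S` of times: it is `C²` there and, near each time of `S`, it
satisfies in some chart the geodesic equation `u'' + Γ(u', u') = 0`, where `u` is `β` read in the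
chart. The equation is written with lowered index, `g(u'', w) + [u'u', w] = 0` for all `w`. -/
def IsGeodesicOn (β : ℝ → N) (S : Set ℝ) : Prop :=
  ContMDiffOn 𝓘(ℝ, ℝ) 𝓘(ℝ, E) 2 β S ∧
  ∀ t ∈ S, ∃ x₀ : N, ∀ᶠ s in 𝓝 t, β s ∈ (chartAt E x₀).source ∧
    ∀ w : E,
      let u : ℝ → E := fun τ => extChartAt 𝓘(ℝ, E) x₀ (β τ)
      metricInChart x₀ (u s) (deriv (deriv u) s) w
        + christoffelFirst x₀ (u s) (deriv u s) (deriv u s) w = 0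

/-- `D` is, on the open set `W`, a smooth distribution of rank `k` (a smooth rank `k` subbundle of
the tangent bundle): near each point of `W` it is spanned by `k` smooth vector fields that are
linearly independent at each point. -/
def IsSmoothDistributionOn (D : ∀ q : N, Submodule ℝ (TangentSpace 𝓘(ℝ, E) q)) (k : ℕ)
    (W : Set N) : Prop :=
  ∀ q₀ ∈ W, ∃ U ∈ 𝓝 q₀, ∃ σ : Fin k → (∀ q : N, TangentSpace 𝓘(ℝ, E) q),
    (∀ i, ContMDiffOn 𝓘(ℝ, E) (𝓘(ℝ, E).prod 𝓘(ℝ, E)) ∞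
      (fun q => (⟨q, σ i q⟩ : TangentBundle 𝓘(ℝ, E) N)) U) ∧
    ∀ q ∈ U, LinearIndependent ℝ (fun i => σ i q) ∧
      Submodule.span ℝ (Set.range (fun i => σ i q)) = D q

/-- Clairaut's relation for a distribution `D` on `W` and a function `s`: along each geodesic `β`
of the manifold that runs in `W`, with components `X ∈ D` and `V ∈ Dᗮ` of the velocity, the function
`s(β(t)) sin ω(t)` is constant, `ω(t)` being the angle between `β'(t)` and `V(t)`. (The angle with a
zero vector is `π / 2`, so that `sin ω = 1` where `β'` is a nonzero vector of `D`.) -/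
def ClairautRelation (D : ∀ q : N, Submodule ℝ (TangentSpace 𝓘(ℝ, E) q)) (W : Set N)
    (s : N → ℝ) : Prop :=
  ∀ (a b : ℝ) (β : ℝ → N), (∀ t ∈ Ioo a b, β t ∈ W) → IsGeodesicOn (E := E) β (Ioo a b) →
    ∀ X V : ∀ t : ℝ, TangentSpace 𝓘(ℝ, E) (β t),
      (∀ t ∈ Ioo a b, X t ∈ D (β t) ∧ V t ∈ (D (β t))ᗮ ∧ velocity β t = X t + V t) →
      ∃ c : ℝ, ∀ t ∈ Ioo a b,
        s (β t) * Real.sin (InnerProductGeometry.angle (velocity β t) (V t)) = c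

end Geodesics

section Kahler

variable {E : Type*} [NormedAddCommGroup E] [NormedSpace ℝ E] [FiniteDimensional ℝ E]
  {N : Type*} [TopologicalSpace N] [ChartedSpace E N] [IsManifold 𝓘(ℝ, E) ∞ N]
  [RiemannianBundle (fun x : N => TangentSpace 𝓘(ℝ, E) x)]
  [IsContMDiffRiemannianBundle 𝓘(ℝ, E) ∞ E (fun x : N => TangentSpace 𝓘(ℝ, E) x)]

/-- `nabla` is the Levi-Civita connection: metric and without torsion. This determines it on
differentiable vector fields. -/
def IsLeviCivita
    (nabla : CovariantDerivative 𝓘(ℝ, E) E (TangentSpace 𝓘(ℝ, E) : N → Type _)) : Prop :=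
  CovariantDerivative.IsMetricCompatible (F := E) (V := fun x : N => TangentSpace 𝓘(ℝ, E) x) nabla ∧ nabla.torsion = 0

/-- `(N, g, J)` is a Kähler manifold: `J` is a smooth field of endomorphisms with `J² = -1`,
orthogonal for the metric, and parallel, `∇(JY) = J ∇Y`, for the Levi-Civita connection `∇`. -/
structure IsKahler
    (J : ∀ q : N, TangentSpace 𝓘(ℝ, E) q →L[ℝ] TangentSpace 𝓘(ℝ, E) q) : Prop where
  smooth : ContMDiff 𝓘(ℝ, E) (𝓘(ℝ, E).prod 𝓘(ℝ, E →L[ℝ] E)) ∞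
    (fun q => TotalSpace.mk' (E →L[ℝ] E)
      (E := fun q : N => TangentSpace 𝓘(ℝ, E) q →L[ℝ] TangentSpace 𝓘(ℝ, E) q) q (J q))
  sq : ∀ (q : N) (v : TangentSpace 𝓘(ℝ, E) q), J q (J q v) = -v
  orthogonal : ∀ (q : N) (v w : TangentSpace 𝓘(ℝ, E) q), ⟪J q v, J q w⟫ = ⟪v, w⟫
  parallel : ∃ nabla : CovariantDerivative 𝓘(ℝ, E) E (TangentSpace 𝓘(ℝ, E) : N → Type _),
    IsLeviCivita nabla ∧
    ∀ (Y : ∀ q : N, TangentSpace 𝓘(ℝ, E) q) (q : N),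
      MDifferentiableAt 𝓘(ℝ, E) (𝓘(ℝ, E).prod 𝓘(ℝ, E))
        (fun x => (⟨x, Y x⟩ : TangentBundle 𝓘(ℝ, E) N)) q →
      ∀ v : TangentSpace 𝓘(ℝ, E) q,
        nabla (fun x => J x (Y x)) q v = J q (nabla Y q v)

end Kahler

section Maps

variable {E₁ : Type*} [NormedAddCommGroup E₁] [NormedSpace ℝ E₁]
  {M : Type*} [TopologicalSpace M] [ChartedSpace E₁ M]
  [RiemannianBundle (fun x : M => TangentSpace 𝓘(ℝ, E₁) x)]
  {E₂ : Type*} [NormedAddCommGroup E₂] [NormedSpace ℝ E₂]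
  {N : Type*} [TopologicalSpace N] [ChartedSpace E₂ N] [IsManifold 𝓘(ℝ, E₂) ∞ N]
  [RiemannianBundle (fun x : N => TangentSpace 𝓘(ℝ, E₂) x)]

/-- The differential `F_*` at `p`. -/
def diff (F : M → N) (p : M) : TangentSpace 𝓘(ℝ, E₁) p →L[ℝ] TangentSpace 𝓘(ℝ, E₂) (F p) :=
  mfderiv 𝓘(ℝ, E₁) 𝓘(ℝ, E₂) F p

/-- The subspace `F_*(T_p M)` of the tangent space at `F p`. -/
def rangeDiff (F : M → N) (p : M) : Submodule ℝ (TangentSpace 𝓘(ℝ, E₂) (F p)) :=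
  LinearMap.range (diff (E₁ := E₁) (E₂ := E₂) F p).toLinearMap

/-- The subspace `ker F_*` of the tangent space at `p`. -/
def kerDiff (F : M → N) (p : M) : Submodule ℝ (TangentSpace 𝓘(ℝ, E₁) p) :=
  LinearMap.ker (diff (E₁ := E₁) (E₂ := E₂) F p).toLinearMap

/-- Riemannian maps: smooth maps of positive (constant) rank whose differential is isometric on the
orthogonal complement of its kernel. -/
structure IsRiemannianMap (F : M → N) : Prop where
  smooth : ContMDiff 𝓘(ℝ, E₁) 𝓘(ℝ, E₂) ∞ F
  rank : ∃ k : ℕ, 0 < k ∧ ∀ p, Module.finrank ℝ (rangeDiff (E₁ := E₁) (E₂ := E₂) F p) = k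
  isometric : ∀ (p : M), ∀ X ∈ (kerDiff (E₁ := E₁) (E₂ := E₂) F p)ᗮ,
    ∀ Y ∈ (kerDiff (E₁ := E₁) (E₂ := E₂) F p)ᗮ,
      ⟪diff (E₂ := E₂) F p X, diff (E₂ := E₂) F p Y⟫ = ⟪X, Y⟫

/-- Anti-invariance: `J (range F_*) ⊆ (range F_*)ᗮ` at each point. -/
def IsAntiInvariant (J : ∀ q : N, TangentSpace 𝓘(ℝ, E₂) q →L[ℝ] TangentSpace 𝓘(ℝ, E₂) q)
    (F : M → N) : Prop :=
  ∀ p, ∀ v ∈ rangeDiff (E₁ := E₁) (E₂ := E₂) F p,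
    J (F p) v ∈ (rangeDiff (E₁ := E₁) (E₂ := E₂) F p)ᗮ

/-- `F` satisfies Clairaut's condition with the function `s` on `N`. To split the velocity of a
geodesic of `N` into its components in `range F_*` and `(range F_*)ᗮ` at all times, `range F_*` has
to be regarded as a distribution on `N`. This is asked for locally only: near each point of `M`,
`range F_*` is the restriction of a smooth distribution `D` on an open set `W` of `N`, and the
geodesics that run in `W` satisfy Clairaut's relation for `D` and `s`. -/
def IsClairaut (F : M → N) (s : N → ℝ) : Prop :=
  ∀ p₀ : M, ∃ (U : Set M) (W : Set N) (k : ℕ)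
    (D : ∀ q : N, Submodule ℝ (TangentSpace 𝓘(ℝ, E₂) q)),
    IsOpen U ∧ p₀ ∈ U ∧ IsOpen W ∧ MapsTo F U W ∧
    IsSmoothDistributionOn D k W ∧
    (∀ p ∈ U, D (F p) = rangeDiff (E₁ := E₁) (E₂ := E₂) F p) ∧
    ClairautRelation D W s

end Maps

end ClairautMap

end

/-! Let `P` be the orthogonal projection of `TN` onto `D`. Since `sin² ω |β'|² = ⟨Pβ', β'⟩`,
Clairaut's relation makes `e^{2g}⟨Pβ', β'⟩` a constant multiple of `|β'|²`, hence constant along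
each geodesic. Differentiating at one point, for every initial velocity `v`, gives the cubic
identity `2 dg(v)⟨Pv, v⟩ + ⟨(∇_v P)v, v⟩ = 0` (`ClairautRelation.firstIntegral`). Its part quadratic
in `x ∈ D` and linear in `w ∈ Dᗮ` says `⟨B(x, x), w⟩ = -dg(w)|x|²`, where `B` is the second
fundamental form of `D`: the distribution is umbilic (`umbilic_of_firstIntegral`).

On vectors `a, b, c` of `range F_*` there are two more symmetries. `B(a, b) = B(b, a)`, because
second derivatives of `F` commute (`fderiv_projection_symm`). And `⟨B(a, b), Jc⟩ = ⟨B(a, c), Jb⟩`,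
by differentiating `⟨b, Jc⟩ = 0` with `∇J = 0` (`IsKahler.secondForm_symm`). Away from the image of
`F`, `D` need be neither integrable nor totally real, so both arguments differentiate only along
`F`.

If the rank is at least two, each `z` in `range F_*` has some `x ≠ 0` in `range F_*` orthogonal to
it, and `dg(Jz)|x|² = -⟨B(x, x), Jz⟩ = -⟨B(x, z), Jx⟩ = dg(Jx)⟨x, z⟩ = 0`
(`mean_curvature_eq_zero`). The computation takes place in a chart around `F p`. -/

noncomputable section

namespace ClairautMap

set_option linter.unusedSectionVars false

/-! ### Geodesics, orthogonal projections and Clairaut's integral for a metric on an open set of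
`E`. -/

section Coordinates

variable {E : Type*} [NormedAddCommGroup E] [NormedSpace ℝ E]

/-- The derivative `∂_a G(b, c)` at `y` of a field `G` of bilinear forms on `E`. -/
def metricDeriv (G : E → E →L[ℝ] E →L[ℝ] ℝ) (y a b c : E) : ℝ :=
  fderiv ℝ (fun z => G z b c) y a

/-- The Christoffel symbols of the first kind of a field `G` of bilinear forms on `E`. -/
def christoffel (G : E → E →L[ℝ] E →L[ℝ] ℝ) (y a b c : E) : ℝ :=
  (metricDeriv G y a b c + metricDeriv G y b a c - metricDeriv G y c a b) / 2

theorem hasDerivAt_comp_curve {F : Type*} [NormedAddCommGroup F] [NormedSpace ℝ F] {f : E → F}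
    {u : ℝ → E} {v : E} {t : ℝ} (hf : DifferentiableAt ℝ f (u t)) (hu : HasDerivAt u v t) :
    HasDerivAt (fun t => f (u t)) (fderiv ℝ f (u t) v) t :=
  hf.hasFDerivAt.comp_hasDerivAt t hu

theorem fderiv_clm_apply_const {F F' : Type*} [NormedAddCommGroup F] [NormedSpace ℝ F]
    [NormedAddCommGroup F'] [NormedSpace ℝ F'] {f : E → F →L[ℝ] F'} {y : E}
    (hf : DifferentiableAt ℝ f y) (v : E) (b : F) :
    fderiv ℝ (fun z => f z b) y v = fderiv ℝ f y v b := by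
  simp [fderiv_clm_apply hf (differentiableAt_const b)]

/-- Leibniz' rule for a field of linear maps along a curve. -/
theorem hasDerivAt_clm_comp_curve {F F' : Type*} [NormedAddCommGroup F] [NormedSpace ℝ F]
    [NormedAddCommGroup F'] [NormedSpace ℝ F'] {f : E → F →L[ℝ] F'} {u : ℝ → E} {b : ℝ → F}
    {v : E} {b' : F} {t : ℝ} (hf : DifferentiableAt ℝ f (u t)) (hu : HasDerivAt u v t)
    (hb : HasDerivAt b b' t) :
    HasDerivAt (fun t => f (u t) (b t)) (fderiv ℝ (fun z => f z (b t)) (u t) v + f (u t) b') t := by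
  rw [fderiv_clm_apply_const hf]
  exact (hasDerivAt_comp_curve hf hu).clm_apply hb

/-- Leibniz' rule for a field of bilinear forms along a curve. -/
theorem hasDerivAt_bilin {G : E → E →L[ℝ] E →L[ℝ] ℝ} {u b c : ℝ → E} {v b' c' : E} {t : ℝ}
    (hG : DifferentiableAt ℝ G (u t)) (hu : HasDerivAt u v t) (hb : HasDerivAt b b' t)
    (hc : HasDerivAt c c' t) :
    HasDerivAt (fun t => G (u t) (b t) (c t))
      (metricDeriv G (u t) v (b t) (c t) + G (u t) b' (c t) + G (u t) (b t) c') t := by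
  have h := (hasDerivAt_clm_comp_curve hG hu hb).clm_apply hc
  rw [_root_.add_apply, ← fderiv_clm_apply_const (hG.clm_apply (differentiableAt_const _))] at h
  exact h

theorem metricDeriv_symm {G : E → E →L[ℝ] E →L[ℝ] ℝ} {y : E}
    (hG : ∀ᶠ z in 𝓝 y, ∀ a b, G z a b = G z b a) (a b c : E) :
    metricDeriv G y a b c = metricDeriv G y a c b := by
  have : (fun z => G z b c) =ᶠ[𝓝 y] fun z => G z c b := hG.mono fun z hz => hz b c
  rw [metricDeriv, this.fderiv_eq, metricDeriv]

theorem isInvertible_of_pos [FiniteDimensional ℝ E] {B : E →L[ℝ] E →L[ℝ] ℝ}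
    (hB : ∀ a, a ≠ 0 → 0 < B a a) : B.IsInvertible := by
  have hinj : Function.Injective B := by
    rw [injective_iff_map_eq_zero]
    intro a ha
    by_contra h
    have := hB a h
    simp [ha] at this
  have hdim : Module.finrank ℝ E = Module.finrank ℝ (E →L[ℝ] ℝ) := by
    rw [← (LinearMap.toContinuousLinearMap (𝕜 := ℝ) (E := E) (F' := ℝ)).finrank_eq]
    exact (Subspace.dual_finrank_eq (K := ℝ) (V := E)).symm
  exact ⟨(LinearEquiv.ofInjectiveOfFinrankEq B.toLinearMap hinj hdim).toContinuousLinearEquiv,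
    by ext; rfl⟩

/-- The linear form `christoffel G y w w`. -/
def christoffelDual (G : E → E →L[ℝ] E →L[ℝ] ℝ) (p : E × E) : E →L[ℝ] ℝ :=
  fderiv ℝ (fun z => G z p.2) p.1 p.2 - (1 / 2 : ℝ) • fderiv ℝ (fun z => G z p.2 p.2) p.1

theorem christoffelDual_apply {G : E → E →L[ℝ] E →L[ℝ] ℝ} {y : E} (hG : DifferentiableAt ℝ G y)
    (w c : E) : christoffelDual G (y, w) c = christoffel G y w w c := by
  have h := fderiv_clm_apply_const (f := fun z => G z w)
    (hG.clm_apply (differentiableAt_const w)) w c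
  simp only [christoffelDual, _root_.sub_apply, _root_.smul_apply, smul_eq_mul, christoffel,
    metricDeriv]
  rw [← h]
  ring

/-- The point `p.1` of differentiation moves with the parameter `p`, hence the joint smoothness in
`(p, z)`. Class `C¹` is what the existence theorem for the geodesic equation needs. -/
theorem contDiffAt_christoffelDual {G : E → E →L[ℝ] E →L[ℝ] ℝ} {p : E × E}
    (hG : ContDiffAt ℝ ∞ G p.1) : ContDiffAt ℝ 1 (christoffelDual G) p := by
  have hG2 : ContDiffAt ℝ 2 G p.1 := hG.of_le (by norm_cast)
  have hw : ContDiffAt ℝ 2 (fun q : (E × E) × E => q.1.2) (p, p.1) :=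
    (contDiff_snd.comp contDiff_fst).contDiffAt
  have h1 : ContDiffAt ℝ 2 (Function.uncurry fun (p : E × E) (z : E) => G z p.2) (p, p.1) :=
    (hG2.comp (p, p.1) contDiffAt_snd).clm_apply hw
  have h2 : ContDiffAt ℝ 2 (Function.uncurry fun (p : E × E) (z : E) => G z p.2 p.2) (p, p.1) :=
    h1.clm_apply hw
  have d1 := h1.fderiv (m := 1) contDiffAt_fst (by norm_num)
  have d2 := h2.fderiv (m := 1) contDiffAt_fst (by norm_num)
  exact (d1.clm_apply contDiffAt_snd).sub (d2.const_smul (1 / 2 : ℝ))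

/-- The acceleration of a geodesic as a function of position and velocity. -/
def acceleration (G : E → E →L[ℝ] E →L[ℝ] ℝ) (p : E × E) : E :=
  -(G p.1).inverse (christoffelDual G p)

theorem contDiffAt_acceleration [FiniteDimensional ℝ E] {G : E → E →L[ℝ] E →L[ℝ] ℝ} {p : E × E}
    (hG : ContDiffAt ℝ ∞ G p.1) (hpos : ∀ a, a ≠ 0 → 0 < G p.1 a a) :
    ContDiffAt ℝ 1 (acceleration G) p := by
  have : CompleteSpace E := FiniteDimensional.complete ℝ E
  have h4 : ContDiffAt ℝ 1 (fun p : E × E => (G p.1).inverse) p :=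
    ContDiffAt.comp (f := fun p : E × E => G p.1) p
      (ContinuousLinearMap.IsInvertible.contDiffAt_map_inverse (isInvertible_of_pos hpos))
      ((hG.of_le (by norm_cast)).comp p contDiffAt_fst)
  exact (h4.clm_apply (contDiffAt_christoffelDual hG)).neg

/-- Positivity makes `G y` invertible, so that `inverse` is a true inverse and not its default value
`0`. -/
theorem acceleration_spec [FiniteDimensional ℝ E] {G : E → E →L[ℝ] E →L[ℝ] ℝ} {y : E}
    (hG : DifferentiableAt ℝ G y) (hpos : ∀ a, a ≠ 0 → 0 < G y a a) (w c : E) :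
    G y (acceleration G (y, w)) c + christoffel G y w w c = 0 := by
  rw [acceleration, map_neg, (isInvertible_of_pos hpos).self_apply_inverse]
  simp [christoffelDual_apply hG]

/-- Local existence of geodesics of a smooth positive definite `G` with given initial velocity. -/
theorem exists_geodesic [FiniteDimensional ℝ E] {G : E → E →L[ℝ] E →L[ℝ] ℝ} {Ω : Set E}
    (hΩ : IsOpen Ω) (hG : ContDiffOn ℝ ∞ G Ω) (hpos : ∀ z ∈ Ω, ∀ a, a ≠ 0 → 0 < G z a a)
    {y : E} (hy : y ∈ Ω) (v : E) :
    ∃ ε > 0, ∃ u w : ℝ → E, u 0 = y ∧ w 0 = v ∧ ContDiffOn ℝ 2 u (Ioo (-ε) ε) ∧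
      ∀ t ∈ Ioo (-ε) ε, u t ∈ Ω ∧ HasDerivAt u (w t) t ∧
        HasDerivAt w (acceleration G (u t, w t)) t := by
  have : CompleteSpace E := FiniteDimensional.complete ℝ E
  have hsm : ∀ z ∈ Ω, ∀ w, ContDiffAt ℝ 1 (acceleration G) (z, w) := fun z hz w =>
    contDiffAt_acceleration (hG.contDiffAt (hΩ.mem_nhds hz)) (hpos z hz)
  have hf : ContDiffAt ℝ 1 (fun p : E × E => (p.2, acceleration G p)) (y, v) :=
    contDiffAt_snd.prodMk (hsm y hy v)
  -- Picard–Lindelöf for the first-order system `u' = w`, `w' = acceleration G (u, w)`. The solution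
  -- may leave `Ω`, so the time interval is shrunk afterwards.
  obtain ⟨α, hα0, δ, hδ, hα⟩ :=
    hf.exists_forall_mem_closedBall_exists_eq_forall_mem_Ioo_hasDerivAt₀ 0
  simp only [zero_sub, zero_add] at hα
  have hcont : ContinuousAt (fun t => (α t).1) 0 :=
    continuous_fst.continuousAt.comp (hα 0 ⟨by linarith, hδ⟩).continuousAt
  have hmem : ∀ᶠ t in 𝓝 (0 : ℝ), (α t).1 ∈ Ω :=
    hcont.eventually_mem (hΩ.mem_nhds (by simpa [hα0] using hy))
  obtain ⟨η, hη, hηΩ⟩ := Metric.eventually_nhds_iff_ball.1 hmem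
  rw [Real.ball_eq_Ioo] at hηΩ
  simp only [zero_sub, zero_add] at hηΩ
  set ε := min δ η
  have hsub : ∀ t ∈ Ioo (-ε) ε, t ∈ Ioo (-δ) δ ∧ t ∈ Ioo (-η) η := by
    intro t ht
    have h1 := min_le_left δ η
    have h2 := min_le_right δ η
    exact ⟨⟨by linarith [ht.1], by linarith [ht.2]⟩, ⟨by linarith [ht.1], by linarith [ht.2]⟩⟩
  have hu : ∀ t ∈ Ioo (-ε) ε, HasDerivAt (fun t => (α t).1) (α t).2 t := fun t ht =>
    (hα t (hsub t ht).1).fst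
  have hw : ∀ t ∈ Ioo (-ε) ε, HasDerivAt (fun t => (α t).2)
      (acceleration G ((α t).1, (α t).2)) t := fun t ht =>
    (hα t (hsub t ht).1).snd
  -- Bootstrap: `w'` is continuous by the equation, so `w` is `C¹`; as `u' = w`, `u` is `C²`.
  have hw1 : ContDiffOn ℝ 1 (fun t => (α t).2) (Ioo (-ε) ε) := by
    rw [show (1 : WithTop ℕ∞) = 0 + 1 by norm_num, contDiffOn_succ_iff_deriv_of_isOpen isOpen_Ioo]
    refine ⟨fun t ht => (hw t ht).differentiableAt.differentiableWithinAt, by simp, ?_⟩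
    rw [contDiffOn_zero]
    have : ContinuousOn (fun t => acceleration G (α t)) (Ioo (-ε) ε) := fun t ht =>
      (ContinuousAt.comp (f := α) (g := acceleration G)
        (hsm _ (hηΩ t (hsub t ht).2) (α t).2).continuousAt
        (hα t (hsub t ht).1).continuousAt).continuousWithinAt
    exact this.congr fun t ht => (hw t ht).deriv
  refine ⟨ε, lt_min hδ hη, fun t => (α t).1, fun t => (α t).2, by simp [hα0], by simp [hα0], ?_,
    fun t ht => ⟨hηΩ t (hsub t ht).2, hu t ht, hw t ht⟩⟩
  rw [show (2 : WithTop ℕ∞) = 1 + 1 by norm_num, contDiffOn_succ_iff_deriv_of_isOpen isOpen_Ioo]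
  exact ⟨fun t ht => (hu t ht).differentiableAt.differentiableWithinAt, by simp,
    hw1.congr fun t ht => (hu t ht).deriv⟩

/-- A smooth frame has a smooth field of orthogonal projections onto its span. -/
theorem exists_orthogonal_projection {G : E → E →L[ℝ] E →L[ℝ] ℝ} {y : E}
    (hG : ContDiffAt ℝ ∞ G y) (hpos : ∀ᶠ z in 𝓝 y, ∀ a, a ≠ 0 → 0 < G z a a) {k : ℕ}
    {σ : Fin k → E → E} (hσ : ∀ i, ContDiffAt ℝ ∞ (σ i) y)
    (hlin : ∀ᶠ z in 𝓝 y, LinearIndependent ℝ (fun i => σ i z)) :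
    ∃ P : E → E →L[ℝ] E, ContDiffAt ℝ ∞ P y ∧ ∀ᶠ z in 𝓝 y, ∀ a,
      P z a ∈ Submodule.span ℝ (range fun i => σ i z) ∧ ∀ i, G z (σ i z) (a - P z a) = 0 := by
  -- The projection is `T (S T)⁻¹ S`: `T` combines the frame vectors, `S` takes products with them,
  -- and `S T` is the Gram matrix, invertible because the frame is independent and `G` is positive
  -- definite.
  let T : E → (Fin k → ℝ) →L[ℝ] E := fun z =>
    ∑ i, (ContinuousLinearMap.proj (R := ℝ) (φ := fun _ : Fin k => ℝ) i).smulRight (σ i z)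
  let S : E → E →L[ℝ] (Fin k → ℝ) := fun z => ContinuousLinearMap.pi fun i => G z (σ i z)
  have hTapp : ∀ z c, T z c = ∑ i, c i • σ i z := fun z c => by
    simp [T]
  have hinv : ∀ z, (∀ a, a ≠ 0 → 0 < G z a a) → LinearIndependent ℝ (fun i => σ i z) →
      (S z ∘L T z).IsInvertible := by
    intro z hz hl
    have hinj : Function.Injective (S z ∘L T z) := by
      rw [injective_iff_map_eq_zero]
      intro c hc
      have h0 : G z (T z c) (T z c) = 0 := by
        have hsum : G z (T z c) (T z c) = ∑ i, c i * G z (σ i z) (T z c) := by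
          have h := congrArg (fun d => G z d (T z c)) (hTapp z c)
          simpa only [map_sum, map_smul, _root_.sum_apply, _root_.smul_apply, smul_eq_mul] using h
        rw [hsum]
        refine Finset.sum_eq_zero fun i _ => ?_
        have := congrFun hc i
        simp only [S, ContinuousLinearMap.comp_apply, ContinuousLinearMap.pi_apply] at this
        simp [this]
      have h1 : T z c = 0 := by
        by_contra h
        exact (hz _ h).ne' h0
      rw [hTapp] at h1
      exact funext (Fintype.linearIndependent_iff.1 hl c h1)
    exact ⟨(LinearEquiv.ofInjectiveEndo (S z ∘L T z).toLinearMap hinj).toContinuousLinearEquiv,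
      by ext; rfl⟩
  have hT : ContDiffAt ℝ ∞ T y := by
    refine ContDiffAt.sum fun i _ => ?_
    exact ((ContinuousLinearMap.smulRightL ℝ (Fin k → ℝ) E
      (ContinuousLinearMap.proj i)).contDiff.contDiffAt).comp y (hσ i)
  have hS : ContDiffAt ℝ ∞ S y := by
    -- A sum of operators of rank at most one, each visibly smooth in `z`.
    have hΦ : S = fun z => ∑ i, ContinuousLinearMap.smulRightL ℝ E (Fin k → ℝ) (G z (σ i z))
        (Pi.single i 1) := by
      funext z
      ext a j
      simp [S, Pi.single_apply]
    rw [hΦ]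
    refine ContDiffAt.sum fun i _ => ?_
    exact ((((ContinuousLinearMap.smulRightL ℝ E (Fin k → ℝ)).contDiff).contDiffAt).comp y
      (hG.clm_apply (hσ i))).clm_apply contDiffAt_const
  refine ⟨fun z => T z ∘L ((S z ∘L T z).inverse ∘L S z), ?_, ?_⟩
  · have h := hinv y hpos.self_of_nhds hlin.self_of_nhds
    exact hT.clm_comp ((ContDiffAt.comp y
      (ContinuousLinearMap.IsInvertible.contDiffAt_map_inverse h)
      (hS.clm_comp hT)).clm_comp hS)
  · filter_upwards [hpos, hlin] with z hz hl a
    refine ⟨?_, fun i => ?_⟩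
    · simp only [ContinuousLinearMap.comp_apply]
      rw [hTapp]
      exact Submodule.sum_mem _ fun i _ =>
        Submodule.smul_mem _ _ (Submodule.subset_span ⟨i, rfl⟩)
    · have h := (hinv z hz hl).self_apply_inverse (S z a)
      have h' := congrFun h i
      simp only [ContinuousLinearMap.comp_apply, S, ContinuousLinearMap.pi_apply] at h'
      rw [map_sub, sub_eq_zero]
      exact h'.symm

/-- The derivative of Clairaut's first integral along a geodesic. -/
theorem clairaut_deriv {G : E → E →L[ℝ] E →L[ℝ] ℝ} {P : E → E →L[ℝ] E} {s : E → ℝ} {y v a : E}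
    (hG : DifferentiableAt ℝ G y) (hP : DifferentiableAt ℝ P y) (hs : DifferentiableAt ℝ s y)
    (hPsymm : ∀ b c, G y (P y b) c = G y b (P y c)) (hGsymm : ∀ b c, G y b c = G y c b)
    {u w : ℝ → E} (hu0 : u 0 = y) (hw0 : w 0 = v)
    (hu : HasDerivAt u v 0) (hw : HasDerivAt w a 0)
    (ha : ∀ c, G y a c + christoffel G y v v c = 0) {C : ℝ}
    (hC : ∀ᶠ t in 𝓝 (0 : ℝ), Real.exp (2 * s (u t)) * G (u t) (P (u t) (w t)) (w t)
      = C * G (u t) (w t) (w t)) :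
    2 * fderiv ℝ s y v * G y (P y v) v + metricDeriv G y v (P y v) v + G y (fderiv ℝ P y v v) v
      - 2 * christoffel G y v v (P y v) = 0 := by
  subst hu0 hw0
  have hPw := (hasDerivAt_comp_curve hP hu).clm_apply hw
  have h1 := hasDerivAt_bilin hG hu hPw hw
  have h2 := (hasDerivAt_bilin hG hu hw hw).const_mul C
  have h3 := (((hasDerivAt_comp_curve hs hu).const_mul 2).exp).mul h1
  have key := (h3.congr_of_eventuallyEq (hC.mono fun t ht => ht.symm)).unique h2
  have hch : christoffel G (u 0) (w 0) (w 0) (w 0)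
      = metricDeriv G (u 0) (w 0) (w 0) (w 0) / 2 := by
    simp [christoffel]
  -- `e1` expresses constant speed and kills the derivative of the right-hand side, whatever `C` is;
  -- `e2` eliminates the acceleration from the left-hand side.
  have e1 := ha (w 0)
  have e2 := ha (P (u 0) (w 0))
  rw [hch] at e1
  rw [map_add, _root_.add_apply] at key
  rw [hGsymm (w 0) a, hPsymm a (w 0), hGsymm (P (u 0) (w 0)) a] at key
  have hexp := (Real.exp_pos (2 * s (u 0))).ne'
  apply mul_left_cancel₀ hexp
  linear_combination key + 2 * C * e1 - 2 * Real.exp (2 * s (u 0)) * e2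

end Coordinates

/-! ### Umbilicity and the symmetries of the second fundamental form. -/

section SecondFundamentalForm

variable {E : Type*} [NormedAddCommGroup E] [NormedSpace ℝ E]

theorem hasDerivAt_line (y v : E) : HasDerivAt (fun t : ℝ => y + t • v) v 0 := by
  simpa using ((hasDerivAt_id (0 : ℝ)).smul_const v).const_add y

theorem tendsto_line (y v : E) : Tendsto (fun t : ℝ => y + t • v) (𝓝 0) (𝓝 y) := by
  have h := (hasDerivAt_line y v).continuousAt.tendsto
  simpa using h

section Linearity

variable {G : E → E →L[ℝ] E →L[ℝ] ℝ} {y : E}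

theorem metricDeriv_add_left (a a' b c : E) :
    metricDeriv G y (a + a') b c = metricDeriv G y a b c + metricDeriv G y a' b c :=
  map_add _ _ _

theorem metricDeriv_add_mid (hG : DifferentiableAt ℝ G y) (a b b' c : E) :
    metricDeriv G y a (b + b') c = metricDeriv G y a b c + metricDeriv G y a b' c := by
  have h : ∀ b, DifferentiableAt ℝ (fun z => G z b c) y := fun b =>
    (hG.clm_apply (differentiableAt_const b)).clm_apply (differentiableAt_const c)
  simp only [metricDeriv, map_add, _root_.add_apply]
  rw [fderiv_fun_add (h b) (h b'), _root_.add_apply]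

theorem metricDeriv_add_right (hG : DifferentiableAt ℝ G y) (a b c c' : E) :
    metricDeriv G y a b (c + c') = metricDeriv G y a b c + metricDeriv G y a b c' := by
  have h : ∀ c, DifferentiableAt ℝ (fun z => G z b c) y := fun c =>
    (hG.clm_apply (differentiableAt_const b)).clm_apply (differentiableAt_const c)
  simp only [metricDeriv, map_add]
  rw [fderiv_fun_add (h c) (h c'), _root_.add_apply]

theorem metricDeriv_neg_left (a b c : E) : metricDeriv G y (-a) b c = -metricDeriv G y a b c :=
  map_neg _ _

theorem metricDeriv_neg_mid (a b c : E) : metricDeriv G y a (-b) c = -metricDeriv G y a b c := by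
  simp only [metricDeriv, map_neg, _root_.neg_apply]
  rw [fderiv_fun_neg, _root_.neg_apply]

theorem metricDeriv_neg_right (a b c : E) :
    metricDeriv G y a b (-c) = -metricDeriv G y a b c := by
  simp only [metricDeriv, map_neg]
  rw [fderiv_fun_neg, _root_.neg_apply]

theorem metricDeriv_zero_mid (a c : E) : metricDeriv G y a 0 c = 0 := by
  simp [metricDeriv]

end Linearity

/-- `⟨∇_a (P b), c⟩` for a field `P` of endomorphisms with `P b = b` at `y`. -/
def secondForm (G : E → E →L[ℝ] E →L[ℝ] ℝ) (P : E → E →L[ℝ] E) (y a b c : E) : ℝ :=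
  G y (fderiv ℝ P y a b) c + christoffel G y a b c

variable {G : E → E →L[ℝ] E →L[ℝ] ℝ} {P : E → E →L[ℝ] E} {y : E}

theorem secondForm_add_left (hG : DifferentiableAt ℝ G y) (a a' b c : E) :
    secondForm G P y (a + a') b c = secondForm G P y a b c + secondForm G P y a' b c := by
  simp only [secondForm, christoffel, map_add, _root_.add_apply, metricDeriv_add_left,
    metricDeriv_add_mid hG]
  ring

theorem secondForm_add_mid (hG : DifferentiableAt ℝ G y) (a b b' c : E) :
    secondForm G P y a (b + b') c = secondForm G P y a b c + secondForm G P y a b' c := by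
  simp only [secondForm, christoffel, map_add, _root_.add_apply, metricDeriv_add_left,
    metricDeriv_add_mid hG, metricDeriv_add_right hG]
  ring

/-- Polarisation of the equation satisfied by Clairaut's first integral: the distribution
`range P` is umbilic, with mean curvature vector minus the gradient of `s`. -/
theorem umbilic_of_firstIntegral {ds : E →L[ℝ] ℝ} (hG : DifferentiableAt ℝ G y)
    (hP : DifferentiableAt ℝ P y) (hsymm : ∀ᶠ z in 𝓝 y, ∀ a b, G z a b = G z b a)
    (hPP : ∀ᶠ z in 𝓝 y, ∀ a, P z (P z a) = P z a)
    (hPsymm : ∀ᶠ z in 𝓝 y, ∀ a b, G z (P z a) b = G z a (P z b))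
    (hint : ∀ v, 2 * ds v * G y (P y v) v + metricDeriv G y v (P y v) v
      + G y (fderiv ℝ P y v v) v - 2 * christoffel G y v v (P y v) = 0)
    {x w : E} (hx : P y x = x) (hw : P y w = 0) :
    ds w * G y x x + secondForm G P y x x w = 0 := by
  have dP : ∀ v a, HasDerivAt (fun t : ℝ => P (y + t • v) a) (fderiv ℝ P y v a) 0 := by
    intro v a
    have h := hasDerivAt_clm_comp_curve (f := P) (t := 0) (by simpa using hP)
      (hasDerivAt_line y v) (hasDerivAt_const 0 a)
    simpa [fderiv_clm_apply_const hP] using h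
  have hG0 : ∀ v : E, DifferentiableAt ℝ G (y + (0 : ℝ) • v) := fun v => by simpa using hG
  have hP0 : ∀ v : E, DifferentiableAt ℝ P (y + (0 : ℝ) • v) := fun v => by simpa using hP
  have idem : ∀ v a, fderiv ℝ P y v (P y a) + P y (fderiv ℝ P y v a) = fderiv ℝ P y v a := by
    intro v a
    have h := hasDerivAt_clm_comp_curve (hP0 v) (hasDerivAt_line y v) (dP v a)
    have h' := (h.congr_of_eventuallyEq
      (((tendsto_line y v).eventually hPP).mono fun t ht => (ht a).symm)).unique (dP v a)
    simpa [fderiv_clm_apply_const hP] using h'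
  have adj : ∀ v a b, metricDeriv G y v (P y a) b + G y (fderiv ℝ P y v a) b
      = metricDeriv G y v a (P y b) + G y a (fderiv ℝ P y v b) := by
    intro v a b
    have h1 := hasDerivAt_bilin (hG0 v) (hasDerivAt_line y v) (dP v a) (hasDerivAt_const 0 b)
    have h2 := hasDerivAt_bilin (hG0 v) (hasDerivAt_line y v) (hasDerivAt_const 0 a) (dP v b)
    have h' := (h1.congr_of_eventuallyEq
      (((tendsto_line y v).eventually hPsymm).mono fun t ht => (ht a b).symm)).unique h2
    simpa using h'
  have sG := hsymm.self_of_nhds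
  -- The difference `e1 - e2` keeps the terms odd in `w`; subtracting the pure cubic `e3` leaves
  -- those quadratic in `x` and linear in `w`.
  have e1 := hint (x + w)
  have e2 := hint (x + -w)
  have e3 := hint w
  -- The derivative of a projection sends its range into its kernel, which is orthogonal to the
  -- range.
  have zero : G y (fderiv ℝ P y w x) x = 0 := by
    have h := idem w x
    rw [hx] at h
    have h0 : P y (fderiv ℝ P y w x) = 0 := by simpa using h
    rw [← hx, ← hPsymm.self_of_nhds, hx, h0]
    simp
  have a1 := adj x w x
  rw [hw, hx, metricDeriv_zero_mid] at a1
  simp only [map_add, map_neg, hx, hw, neg_zero, add_zero, _root_.add_apply, _root_.neg_apply,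
    christoffel, metricDeriv_add_left, metricDeriv_add_mid hG, metricDeriv_add_right hG,
    metricDeriv_neg_left, metricDeriv_neg_mid, metricDeriv_neg_right] at e1 e2
  simp only [hw, christoffel, metricDeriv_zero_mid, map_zero, _root_.zero_apply, secondForm]
    at e3 ⊢
  have q2 := sG (fderiv ℝ P y x x) w
  have q0 : metricDeriv G y w w 0 = 0 := by simp [metricDeriv]
  have q0' : metricDeriv G y 0 w w = 0 := by simp [metricDeriv]
  rw [q0, q0'] at e3
  have q5 : G y x w = 0 := by
    rw [← hx, hPsymm.self_of_nhds, hw, map_zero]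
  linear_combination (e1 - e2) / 4 - e3 / 2 - ds x * q5 - zero / 2 - a1 / 2 + q2 / 2

/-- The second fundamental form is symmetric along a map with values in integral directions. -/
theorem fderiv_projection_symm {E₁ : Type*} [NormedAddCommGroup E₁] [NormedSpace ℝ E₁]
    {f : E₁ → E} {m : E₁} (hf : ContDiffAt ℝ 2 f m) (hP : DifferentiableAt ℝ P (f m))
    (h : ∀ᶠ z in 𝓝 m, ∀ b, P (f z) (fderiv ℝ f z b) = fderiv ℝ f z b) (a b : E₁) :
    fderiv ℝ P (f m) (fderiv ℝ f m a) (fderiv ℝ f m b)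
      = fderiv ℝ P (f m) (fderiv ℝ f m b) (fderiv ℝ f m a) := by
  have hf1 : DifferentiableAt ℝ f m := hf.differentiableAt (by norm_num)
  have hf2 : DifferentiableAt ℝ (fderiv ℝ f) m :=
    (hf.fderiv_right (m := 1) (by norm_num)).differentiableAt (by norm_num)
  have key : ∀ a b, fderiv ℝ P (f m) (fderiv ℝ f m a) (fderiv ℝ f m b)
      + P (f m) (fderiv ℝ (fderiv ℝ f) m a b) = fderiv ℝ (fderiv ℝ f) m a b := by
    intro a b
    have hl := hasDerivAt_line m a
    have h1 : HasDerivAt (fun t : ℝ => f (m + t • a)) (fderiv ℝ f m a) 0 := by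
      simpa using hasDerivAt_comp_curve (t := 0) (by simpa using hf1) hl
    have h2 : HasDerivAt (fun t : ℝ => fderiv ℝ f (m + t • a) b)
        (fderiv ℝ (fderiv ℝ f) m a b) 0 := by
      have := (hasDerivAt_comp_curve (f := fderiv ℝ f) (t := 0) (by simpa using hf2) hl).clm_apply
        (hasDerivAt_const 0 b)
      simpa using this
    have h3 := hasDerivAt_clm_comp_curve (f := P) (t := 0) (by simpa using hP) h1 h2
    have h4 := (h3.congr_of_eventuallyEq
      (((tendsto_line m a).eventually h).mono fun t ht => (ht b).symm)).unique h2
    simpa [fderiv_clm_apply_const hP] using h4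
  have hs : fderiv ℝ (fderiv ℝ f) m a b = fderiv ℝ (fderiv ℝ f) m b a :=
    (hf.isSymmSndFDerivAt (by simp)).eq a b
  have k1 := key a b
  have k2 := key b a
  rw [hs] at k1
  exact add_right_cancel (k1.trans k2.symm)

/-- An umbilic totally real second fundamental form of rank at least two has mean curvature
orthogonal to `J R`. -/
theorem mean_curvature_eq_zero {ds : E →L[ℝ] ℝ} (hG : DifferentiableAt ℝ G y)
    (hpos : ∀ a, a ≠ 0 → 0 < G y a a) (hsymm : ∀ a b, G y a b = G y b a)
    {R : Submodule ℝ E} [FiniteDimensional ℝ R] (hR : 1 < Module.finrank ℝ R) {J : E → E}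
    (humb : ∀ x ∈ R, ∀ c ∈ R, ds (J c) * G y x x + secondForm G P y x x (J c) = 0)
    (hB : ∀ x ∈ R, ∀ b ∈ R, ∀ w, secondForm G P y x b w = secondForm G P y b x w)
    (hJ : ∀ x ∈ R, ∀ b ∈ R, ∀ c ∈ R, secondForm G P y x b (J c) = secondForm G P y x c (J b))
    {z : E} (hz : z ∈ R) : ds (J z) = 0 := by
  -- The linear form `⟨z, ·⟩` on `R` has a nonzero kernel because `R` has dimension at least two.
  obtain ⟨x, hx, hx0⟩ := Submodule.exists_mem_ne_zero_of_ne_bot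
    (LinearMap.ker_ne_bot_of_finrank_lt
      (f := ((G y z).toLinearMap.comp R.subtype : R →ₗ[ℝ] ℝ)) (by simpa using hR))
  have hxz : G y x z = 0 := by
    rw [hsymm]
    simpa using hx
  have hx0' : (x : E) ≠ 0 := fun h => hx0 (Subtype.ext h)
  -- Polarising umbilicity gives `⟨B(x, z), Jx⟩ = -dg(Jx)⟨x, z⟩`, once `B(x, z) = B(z, x)` is known.
  have hB0 : secondForm G P y x z (J x) = 0 := by
    have h1 := humb (x + z) (R.add_mem x.2 hz) x x.2
    have h2 := humb x x.2 x x.2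
    have h3 := humb z hz x x.2
    have h4 := hB x x.2 z hz (J x)
    simp only [secondForm_add_left hG, secondForm_add_mid hG, map_add, _root_.add_apply] at h1
    have hzx : G y z x = 0 := hsymm z x ▸ hxz
    linear_combination h1 / 2 - h2 / 2 - h3 / 2 + h4 / 2 - ds (J x) * hxz / 2
      - ds (J x) * hzx / 2
  have h1 := humb x x.2 z hz
  rw [hJ x x.2 x x.2 z hz, hB0, add_zero] at h1
  exact (mul_eq_zero.1 h1).resolve_right (hpos _ hx0').ne'

end SecondFundamentalForm

/-! ### Vector fields, Lie brackets and the metric read in a chart. -/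

section Charts

variable {E : Type*} [NormedAddCommGroup E] [NormedSpace ℝ E]
  {N : Type*} [TopologicalSpace N] [ChartedSpace E N] [IsManifold 𝓘(ℝ, E) ∞ N]

/-- The derivative of the chart around `q`, giving the coordinates of tangent vectors. -/
def toChart (q x : N) : TangentSpace 𝓘(ℝ, E) x →L[ℝ] E :=
  mfderiv 𝓘(ℝ, E) 𝓘(ℝ, E) (extChartAt 𝓘(ℝ, E) q) x

/-- The derivative of the inverse of the chart around `q`. -/
def ofChart (q : N) (z : E) : E →L[ℝ] TangentSpace 𝓘(ℝ, E) ((extChartAt 𝓘(ℝ, E) q).symm z) :=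
  mfderiv 𝓘(ℝ, E) 𝓘(ℝ, E) (extChartAt 𝓘(ℝ, E) q).symm z

/-- The vector field with coordinates `Y` in the chart around `q`. -/
def chartField (q : N) (Y : E → E) (x : N) : TangentSpace 𝓘(ℝ, E) x :=
  (toChart q x).inverse (Y (extChartAt 𝓘(ℝ, E) q x))

variable {q : N}

theorem toChart_ofChart {z : E} (hz : z ∈ (extChartAt 𝓘(ℝ, E) q).target) (a : E) :
    toChart q ((extChartAt 𝓘(ℝ, E) q).symm z) (ofChart q z a) = a := by
  have h := mfderiv_extChartAt_comp_mfderivWithin_extChartAt_symm (I := 𝓘(ℝ, E)) hz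
  rw [modelWithCornersSelf_coe, range_id, mfderivWithin_univ] at h
  exact DFunLike.congr_fun h a

theorem ofChart_toChart {z : E} (hz : z ∈ (extChartAt 𝓘(ℝ, E) q).target)
    (v : TangentSpace 𝓘(ℝ, E) ((extChartAt 𝓘(ℝ, E) q).symm z)) :
    ofChart q z (toChart q ((extChartAt 𝓘(ℝ, E) q).symm z) v) = v := by
  have h := mfderivWithin_extChartAt_symm_comp_mfderiv_extChartAt (I := 𝓘(ℝ, E)) hz
  rw [modelWithCornersSelf_coe, range_id, mfderivWithin_univ] at h
  exact DFunLike.congr_fun h v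

theorem isInvertible_toChart {x : N} (hx : x ∈ (extChartAt 𝓘(ℝ, E) q).source) :
    (toChart (E := E) q x).IsInvertible :=
  isInvertible_mfderiv_extChartAt (I := 𝓘(ℝ, E)) hx

theorem toChart_chartField {x : N} (hx : x ∈ (extChartAt 𝓘(ℝ, E) q).source) (Y : E → E) :
    toChart q x (chartField q Y x) = Y (extChartAt 𝓘(ℝ, E) q x) :=
  (isInvertible_toChart hx).self_apply_inverse _

theorem chartField_toChart {x : N} (hx : x ∈ (extChartAt 𝓘(ℝ, E) q).source)
    (v : TangentSpace 𝓘(ℝ, E) x) : chartField q (fun _ => toChart q x v) x = v :=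
  (isInvertible_toChart hx).inverse_apply_self v

theorem chartField_symm {z : E} (hz : z ∈ (extChartAt 𝓘(ℝ, E) q).target) (Y : E → E) :
    chartField q Y ((extChartAt 𝓘(ℝ, E) q).symm z) = ofChart q z (Y z) := by
  have hx := (extChartAt 𝓘(ℝ, E) q).map_target hz
  apply (isInvertible_toChart hx).injective
  rw [toChart_chartField hx, toChart_ofChart hz, (extChartAt 𝓘(ℝ, E) q).right_inv hz]

theorem chartField_congr {x : N} {Y Z : E → E}
    (h : Y (extChartAt 𝓘(ℝ, E) q x) = Z (extChartAt 𝓘(ℝ, E) q x)) :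
    chartField q Y x = chartField q Z x := by
  rw [chartField, chartField, h]

theorem contMDiffAt_chartField [CompleteSpace E] {x : N} {Y : E → E}
    (hx : x ∈ (extChartAt 𝓘(ℝ, E) q).source)
    (hY : ContDiffAt ℝ ∞ Y (extChartAt 𝓘(ℝ, E) q x)) :
    ContMDiffAt 𝓘(ℝ, E) (𝓘(ℝ, E).prod 𝓘(ℝ, E)) ∞
      (fun x => (⟨x, chartField q Y x⟩ : TangentBundle 𝓘(ℝ, E) N)) x :=
  ContMDiffAt.mpullback_vectorField_preimage (V := Y) (n := ∞)
    (contMDiffAt_vectorSpace_iff_contDiffAt.2 hY)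
    (contMDiffAt_extChartAt' (by simpa using hx)) (isInvertible_mfderiv_extChartAt hx)
    (by norm_cast)

theorem mdifferentiableAt_chartField [CompleteSpace E] {x : N} {Y : E → E}
    (hx : x ∈ (extChartAt 𝓘(ℝ, E) q).source)
    (hY : ContDiffAt ℝ ∞ Y (extChartAt 𝓘(ℝ, E) q x)) :
    MDifferentiableAt 𝓘(ℝ, E) (𝓘(ℝ, E).prod 𝓘(ℝ, E))
      (fun x => (⟨x, chartField q Y x⟩ : TangentBundle 𝓘(ℝ, E) N)) x :=
  (contMDiffAt_chartField hx hY).mdifferentiableAt (by simp)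

/-- `chartField` is the pull-back under the chart, and pull-backs commute with Lie brackets. -/
theorem mlieBracket_chartField [CompleteSpace E] {x : N} {Y Z : E → E}
    (hx : x ∈ (extChartAt 𝓘(ℝ, E) q).source)
    (hY : ContDiffAt ℝ ∞ Y (extChartAt 𝓘(ℝ, E) q x))
    (hZ : ContDiffAt ℝ ∞ Z (extChartAt 𝓘(ℝ, E) q x)) :
    VectorField.mlieBracket 𝓘(ℝ, E) (chartField q Y) (chartField q Z) x
      = chartField q (VectorField.lieBracket ℝ Y Z) x := by
  have : IsManifold 𝓘(ℝ, E) (minSmoothness ℝ 2) N := by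
    rw [minSmoothness_of_isRCLikeNormedField]
    exact IsManifold.of_le (n := ∞) (by norm_cast)
  have h := VectorField.mpullback_mlieBracket (I := 𝓘(ℝ, E)) (I' := 𝓘(ℝ, E)) (n := ∞) (x₀ := x)
    (f := extChartAt 𝓘(ℝ, E) q) (V := Y) (W := Z)
    ((contMDiffAt_vectorSpace_iff_contDiffAt.2 hY).mdifferentiableAt (by simp))
    ((contMDiffAt_vectorSpace_iff_contDiffAt.2 hZ).mdifferentiableAt (by simp))
    (contMDiffAt_extChartAt' (by simpa using hx))
    (by rw [minSmoothness_of_isRCLikeNormedField]; norm_cast)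
  have hb := congrFun (VectorField.mlieBracketWithin_eq_lieBracketWithin (𝕜 := ℝ) (V := Y)
    (W := Z) (s := univ)) (extChartAt 𝓘(ℝ, E) q x)
  rw [VectorField.lieBracketWithin_univ] at hb
  exact h.symm.trans (congrArg (fun a : E => (toChart (E := E) q x).inverse a) hb)

/-- The coordinates of a smooth vector field are smooth. -/
theorem contDiffAt_toChart {σ : ∀ x : N, TangentSpace 𝓘(ℝ, E) x} {x : N}
    (hx : x ∈ (extChartAt 𝓘(ℝ, E) q).source)
    (hσ : ContMDiffAt 𝓘(ℝ, E) (𝓘(ℝ, E).prod 𝓘(ℝ, E)) ∞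
      (fun x => (⟨x, σ x⟩ : TangentBundle 𝓘(ℝ, E) N)) x) :
    ContDiffAt ℝ ∞ (fun z => toChart q ((extChartAt 𝓘(ℝ, E) q).symm z)
      (σ ((extChartAt 𝓘(ℝ, E) q).symm z))) (extChartAt 𝓘(ℝ, E) q x) := by
  have hx' : x ∈ (chartAt E q).source := by simpa using hx
  have h1 : ContMDiffAt 𝓘(ℝ, E) 𝓘(ℝ, E) ∞ (fun x => toChart q x (σ x)) x := by
    have h := ((trivializationAt E (TangentSpace 𝓘(ℝ, E)) q).contMDiffAt_section_iff
      (IB := 𝓘(ℝ, E)) (n := ∞) (s := σ) (x₀ := x) (by simpa using hx')).1 hσ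
    -- The trivialization of the tangent bundle at `q` is the derivative of the chart around `q`.
    refine h.congr_of_eventuallyEq ?_
    filter_upwards [(chartAt E q).open_source.mem_nhds hx'] with y hy
    rw [toChart, ← TangentBundle.continuousLinearMapAt_trivializationAt hy,
      Trivialization.continuousLinearMapAt_apply, Trivialization.coe_linearMapAt_of_mem]
    simpa using hy
  have h2 : ContMDiffAt 𝓘(ℝ, E) 𝓘(ℝ, E) ∞ (extChartAt 𝓘(ℝ, E) q).symm
      (extChartAt 𝓘(ℝ, E) q x) :=
    (contMDiffOn_extChartAt_symm q).contMDiffAt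
      ((isOpen_extChartAt_target q).mem_nhds ((extChartAt 𝓘(ℝ, E) q).map_source hx))
  exact (ContMDiffAt.comp_of_eq h1 h2 ((extChartAt 𝓘(ℝ, E) q).left_inv hx)).contDiffAt

theorem mvfderiv_eq_chart {F : Type*} [NormedAddCommGroup F] [NormedSpace ℝ F] {h : N → F}
    {f : E → F} {x : N} (hx : x ∈ (extChartAt 𝓘(ℝ, E) q).source)
    (hf : DifferentiableAt ℝ f (extChartAt 𝓘(ℝ, E) q x))
    (hh : h =ᶠ[𝓝 x] fun x => f (extChartAt 𝓘(ℝ, E) q x)) (v : TangentSpace 𝓘(ℝ, E) x) :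
    mvfderiv 𝓘(ℝ, E) h x v = fderiv ℝ f (extChartAt 𝓘(ℝ, E) q x) (toChart q x v) := by
  have h1 := (hf.hasFDerivAt.hasMFDerivAt).comp x
    (mdifferentiableAt_extChartAt (I := 𝓘(ℝ, E)) (by simpa using hx)).hasMFDerivAt
  have h2 := (h1.congr_of_eventuallyEq hh).mfderiv
  exact DFunLike.congr_fun h2 v

section Metric

variable [FiniteDimensional ℝ E] [RiemannianBundle (fun x : N => TangentSpace 𝓘(ℝ, E) x)]

/-- The metric in the chart around `q`, as a field of bilinear forms. -/
def metricForm (q : N) (z : E) : E →L[ℝ] E →L[ℝ] ℝ :=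
  (LinearMap.mk₂ ℝ (fun a b => ⟪ofChart q z a, ofChart q z b⟫)
    (fun a a' b => by rw [map_add, inner_add_left])
    (fun c a b => by rw [map_smul, real_inner_smul_left, smul_eq_mul])
    (fun a b b' => by rw [map_add, inner_add_right])
    (fun c a b => by rw [map_smul, real_inner_smul_right, smul_eq_mul])).toContinuousBilinearMap

theorem metricForm_apply (z a b : E) :
    metricForm q z a b = ⟪ofChart q z a, ofChart q z b⟫ := rfl

theorem metricForm_symm (z a b : E) : metricForm q z a b = metricForm q z b a := by
  rw [metricForm_apply, metricForm_apply, real_inner_comm]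

theorem metricForm_pos {z : E} (hz : z ∈ (extChartAt 𝓘(ℝ, E) q).target) {a : E} (ha : a ≠ 0) :
    0 < metricForm q z a a := by
  rw [metricForm_apply, real_inner_self_pos]
  intro h
  apply ha
  rw [← toChart_ofChart hz a, h, map_zero]

theorem christoffelFirst_eq (z a b c : E) :
    christoffelFirst q z a b c = christoffel (metricForm q) z a b c := rfl

theorem inner_chartField {x : N} (hx : x ∈ (extChartAt 𝓘(ℝ, E) q).source) (Y Z : E → E) :
    ⟪chartField q Y x, chartField q Z x⟫ = metricForm q (extChartAt 𝓘(ℝ, E) q x)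
      (Y (extChartAt 𝓘(ℝ, E) q x)) (Z (extChartAt 𝓘(ℝ, E) q x)) := by
  obtain ⟨z, hz, rfl⟩ : ∃ z ∈ (extChartAt 𝓘(ℝ, E) q).target,
      (extChartAt 𝓘(ℝ, E) q).symm z = x :=
    ⟨_, (extChartAt 𝓘(ℝ, E) q).map_source hx, (extChartAt 𝓘(ℝ, E) q).left_inv hx⟩
  rw [chartField_symm hz, chartField_symm hz, metricForm_apply,
    (extChartAt 𝓘(ℝ, E) q).right_inv hz]

/-- In finite dimension smoothness can be tested on entries, which are products of smooth fields
with constant coordinates. -/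
theorem contDiffOn_metricForm
    [IsContMDiffRiemannianBundle 𝓘(ℝ, E) ∞ E (fun x : N => TangentSpace 𝓘(ℝ, E) x)] :
    ContDiffOn ℝ ∞ (metricForm q) (extChartAt 𝓘(ℝ, E) q).target := by
  have : CompleteSpace E := FiniteDimensional.complete ℝ E
  rw [contDiffOn_clm_apply]
  intro a
  rw [contDiffOn_clm_apply]
  intro b z hz
  have hx := (extChartAt 𝓘(ℝ, E) q).map_target hz
  have h1 := ContMDiffAt.inner_bundle (F := E) (E := fun x : N => TangentSpace 𝓘(ℝ, E) x)
    (contMDiffAt_chartField hx (Y := fun _ => a) contDiffAt_const)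
    (contMDiffAt_chartField hx (Y := fun _ => b) contDiffAt_const)
  have h2 : ContMDiffAt 𝓘(ℝ, E) 𝓘(ℝ, E) ∞ (extChartAt 𝓘(ℝ, E) q).symm z :=
    (contMDiffOn_extChartAt_symm q).contMDiffAt ((isOpen_extChartAt_target q).mem_nhds hz)
  have h3 := (h1.comp z h2).contDiffAt
  refine (h3.congr_of_eventuallyEq ?_).contDiffWithinAt
  filter_upwards [(isOpen_extChartAt_target (I := 𝓘(ℝ, E)) q).mem_nhds hz] with y hy
  have hy' := (extChartAt 𝓘(ℝ, E) q).map_target hy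
  rw [Function.comp_apply, inner_chartField hy', (extChartAt 𝓘(ℝ, E) q).right_inv hy]

end Metric

end Charts

/-! ### The Levi-Civita connection in coordinates, and the Kähler condition. -/

section Connection

variable {E : Type*} [NormedAddCommGroup E] [NormedSpace ℝ E] [FiniteDimensional ℝ E]
  {N : Type*} [TopologicalSpace N] [ChartedSpace E N] [IsManifold 𝓘(ℝ, E) ∞ N]
  [RiemannianBundle (fun x : N => TangentSpace 𝓘(ℝ, E) x)]
  [IsContMDiffRiemannianBundle 𝓘(ℝ, E) ∞ E (fun x : N => TangentSpace 𝓘(ℝ, E) x)]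
  {nabla : CovariantDerivative 𝓘(ℝ, E) E (TangentSpace 𝓘(ℝ, E) : N → Type _)} {q : N}

theorem IsLeviCivita.mvfderiv_inner (h : IsLeviCivita nabla) {x : N}
    {Y Z : ∀ x : N, TangentSpace 𝓘(ℝ, E) x}
    (hY : MDifferentiableAt 𝓘(ℝ, E) (𝓘(ℝ, E).prod 𝓘(ℝ, E))
      (fun x => (⟨x, Y x⟩ : TangentBundle 𝓘(ℝ, E) N)) x)
    (hZ : MDifferentiableAt 𝓘(ℝ, E) (𝓘(ℝ, E).prod 𝓘(ℝ, E))
      (fun x => (⟨x, Z x⟩ : TangentBundle 𝓘(ℝ, E) N)) x) (v : TangentSpace 𝓘(ℝ, E) x) :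
    mvfderiv 𝓘(ℝ, E) (fun x => ⟪Y x, Z x⟫) x v = ⟪nabla Y x v, Z x⟫ + ⟪Y x, nabla Z x v⟫ := by
  have : CompleteSpace E := FiniteDimensional.complete ℝ E
  -- Metric compatibility is phrased with a field as direction, so `v` is extended to a field.
  have hX : ∃ X : ∀ x : N, TangentSpace 𝓘(ℝ, E) x, X x = v :=
    ⟨chartField x fun _ => toChart x x v, chartField_toChart (mem_extChartAt_source x) v⟩
  obtain ⟨X, rfl⟩ := hX
  exact CovariantDerivative.IsMetricCompatible.mvfderiv_inner_eq (F := E)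
    (V := fun x : N => TangentSpace 𝓘(ℝ, E) x) h.1 X hY hZ

theorem IsLeviCivita.sub_eq_mlieBracket (h : IsLeviCivita nabla) {x : N}
    {Y Z : ∀ x : N, TangentSpace 𝓘(ℝ, E) x}
    (hY : MDifferentiableAt 𝓘(ℝ, E) (𝓘(ℝ, E).prod 𝓘(ℝ, E))
      (fun x => (⟨x, Y x⟩ : TangentBundle 𝓘(ℝ, E) N)) x)
    (hZ : MDifferentiableAt 𝓘(ℝ, E) (𝓘(ℝ, E).prod 𝓘(ℝ, E))
      (fun x => (⟨x, Z x⟩ : TangentBundle 𝓘(ℝ, E) N)) x) :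
    nabla Z x (Y x) - nabla Y x (Z x) = VectorField.mlieBracket 𝓘(ℝ, E) Y Z x := by
  have : CompleteSpace E := FiniteDimensional.complete ℝ E
  exact nabla.torsion_eq_zero_iff.1 h.2 hY hZ

theorem differentiableAt_metricForm {z : E} (hz : z ∈ (extChartAt 𝓘(ℝ, E) q).target) :
    DifferentiableAt ℝ (metricForm q) z :=
  (contDiffOn_metricForm.contDiffAt ((isOpen_extChartAt_target q).mem_nhds hz)).differentiableAt
    (by simp)

/-- The derivative of the product of two fields that have constant coordinates. -/
theorem mvfderiv_inner_const {x : N} (hx : x ∈ (extChartAt 𝓘(ℝ, E) q).source) (a b c : E) :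
    mvfderiv 𝓘(ℝ, E) (fun x => ⟪chartField q (fun _ => b) x, chartField q (fun _ => c) x⟫) x
        (chartField q (fun _ => a) x)
      = metricDeriv (metricForm q) (extChartAt 𝓘(ℝ, E) q x) a b c := by
  have hd := differentiableAt_metricForm ((extChartAt 𝓘(ℝ, E) q).map_source hx)
  rw [mvfderiv_eq_chart (q := q) (f := fun z => metricForm q z b c) hx
    ((hd.clm_apply (differentiableAt_const b)).clm_apply (differentiableAt_const c)) ?_,
    toChart_chartField hx, metricDeriv]
  filter_upwards [(isOpen_extChartAt_source (I := 𝓘(ℝ, E)) q).mem_nhds hx] with y hy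
  exact inner_chartField hy _ _

/-- Koszul's formula for coordinate fields. -/
theorem IsLeviCivita.inner_const (h : IsLeviCivita nabla) {x : N}
    (hx : x ∈ (extChartAt 𝓘(ℝ, E) q).source) (a b c : E) :
    ⟪nabla (chartField q fun _ => b) x (chartField q (fun _ => a) x), chartField q (fun _ => c) x⟫
      = christoffel (metricForm q) (extChartAt 𝓘(ℝ, E) q x) a b c := by
  have : CompleteSpace E := FiniteDimensional.complete ℝ E
  have hd : ∀ a : E, MDifferentiableAt 𝓘(ℝ, E) (𝓘(ℝ, E).prod 𝓘(ℝ, E))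
      (fun x => (⟨x, chartField q (fun _ => a) x⟩ : TangentBundle 𝓘(ℝ, E) N)) x := fun a =>
    mdifferentiableAt_chartField hx contDiffAt_const
  have tors : ∀ a b : E, nabla (chartField q fun _ => b) x (chartField q (fun _ => a) x)
      = nabla (chartField q fun _ => a) x (chartField q (fun _ => b) x) := by
    intro a b
    rw [← sub_eq_zero, h.sub_eq_mlieBracket (hd a) (hd b),
      mlieBracket_chartField hx contDiffAt_const contDiffAt_const]
    simp [chartField, VectorField.lieBracket]
  have met : ∀ a b c : E, metricDeriv (metricForm q) (extChartAt 𝓘(ℝ, E) q x) a b c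
      = ⟪nabla (chartField q fun _ => b) x (chartField q (fun _ => a) x),
          chartField q (fun _ => c) x⟫
        + ⟪nabla (chartField q fun _ => c) x (chartField q (fun _ => a) x),
          chartField q (fun _ => b) x⟫ := by
    intro a b c
    rw [← mvfderiv_inner_const hx, h.mvfderiv_inner (hd b) (hd c)]
    rw [real_inner_comm (chartField q (fun _ => b) x)]
  rw [christoffel, met a b c, met b a c, met c a b, tors b a, tors c a, tors c b]
  ring

theorem christoffel_metricForm_symm (y a b c : E) :
    christoffel (metricForm q) y a b c = christoffel (metricForm q) y b a c := by
  have : metricDeriv (metricForm q) y c a b = metricDeriv (metricForm q) y c b a :=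
    metricDeriv_symm (Eventually.of_forall fun z => metricForm_symm z) _ _ _
  rw [christoffel, christoffel, this]
  ring

/-- The Levi-Civita connection in coordinates. -/
theorem IsLeviCivita.inner_chartField (h : IsLeviCivita nabla) {x : N}
    (hx : x ∈ (extChartAt 𝓘(ℝ, E) q).source) {Y : E → E}
    (hY : ContDiffAt ℝ ∞ Y (extChartAt 𝓘(ℝ, E) q x)) (v c : E) :
    ⟪nabla (chartField q Y) x (chartField q (fun _ => v) x), chartField q (fun _ => c) x⟫
      = metricForm q (extChartAt 𝓘(ℝ, E) q x) (fderiv ℝ Y (extChartAt 𝓘(ℝ, E) q x) v) c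
        + christoffel (metricForm q) (extChartAt 𝓘(ℝ, E) q x) v
          (Y (extChartAt 𝓘(ℝ, E) q x)) c := by
  have : CompleteSpace E := FiniteDimensional.complete ℝ E
  -- Vanishing torsion trades `∇_v Y` for `[v, Y] + ∇_Y v`. The last term depends only on the value
  -- of `Y` at `x`, so Koszul's formula for constant fields applies without expanding `Y` in a
  -- frame.
  have t := h.sub_eq_mlieBracket (mdifferentiableAt_chartField hx (Y := fun _ => v)
    contDiffAt_const) (mdifferentiableAt_chartField hx hY)
  rw [mlieBracket_chartField hx contDiffAt_const hY, sub_eq_iff_eq_add] at t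
  have hc : chartField q Y x = chartField q (fun _ => Y (extChartAt 𝓘(ℝ, E) q x)) x :=
    chartField_congr rfl
  rw [t, inner_add_left, ClairautMap.inner_chartField hx, hc, h.inner_const hx, christoffel_metricForm_symm]
  simp [VectorField.lieBracket]

theorem IsKahler.mdifferentiableAt_apply
    {J : ∀ q : N, TangentSpace 𝓘(ℝ, E) q →L[ℝ] TangentSpace 𝓘(ℝ, E) q} (hJ : IsKahler J)
    {Y : ∀ x : N, TangentSpace 𝓘(ℝ, E) x} {x : N}
    (hY : MDifferentiableAt 𝓘(ℝ, E) (𝓘(ℝ, E).prod 𝓘(ℝ, E))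
      (fun x => (⟨x, Y x⟩ : TangentBundle 𝓘(ℝ, E) N)) x) :
    MDifferentiableAt 𝓘(ℝ, E) (𝓘(ℝ, E).prod 𝓘(ℝ, E))
      (fun x => (⟨x, J x (Y x)⟩ : TangentBundle 𝓘(ℝ, E) N)) x :=
  MDifferentiableAt.clm_bundle_apply (F₁ := E) (F₂ := E) (b := fun x : N => x)
    (E₁ := fun x : N => TangentSpace 𝓘(ℝ, E) x) (E₂ := fun x : N => TangentSpace 𝓘(ℝ, E) x)
    ((hJ.smooth x).mdifferentiableAt (by simp)) hY

/-- On a Kähler manifold the second fundamental form of a totally real distribution is totally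
symmetric. -/
theorem IsKahler.secondForm_symm
    {J : ∀ q : N, TangentSpace 𝓘(ℝ, E) q →L[ℝ] TangentSpace 𝓘(ℝ, E) q} (hJ : IsKahler J)
    {P : E → E →L[ℝ] E} (hP : ContDiffAt ℝ ∞ P (extChartAt 𝓘(ℝ, E) q q)) {a b c : E}
    (hb : P (extChartAt 𝓘(ℝ, E) q q) b = b) (hc : P (extChartAt 𝓘(ℝ, E) q q) c = c)
    (h0 : mvfderiv 𝓘(ℝ, E) (fun x => ⟪chartField q (fun z => P z b) x,
      J x (chartField q (fun z => P z c) x)⟫) q (chartField q (fun _ => a) q) = 0) :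
    secondForm (metricForm q) P (extChartAt 𝓘(ℝ, E) q q) a b
        (toChart q q (J q (chartField q (fun _ => c) q)))
      = secondForm (metricForm q) P (extChartAt 𝓘(ℝ, E) q q) a c
        (toChart q q (J q (chartField q (fun _ => b) q))) := by
  have : CompleteSpace E := FiniteDimensional.complete ℝ E
  obtain ⟨nabla, hLC, hpar⟩ := hJ.parallel
  have hx := mem_extChartAt_source (I := 𝓘(ℝ, E)) q
  have hPb : ∀ b, ContDiffAt ℝ ∞ (fun z => P z b) (extChartAt 𝓘(ℝ, E) q q) := fun b =>
    hP.clm_apply contDiffAt_const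
  have hd : ∀ b, MDifferentiableAt 𝓘(ℝ, E) (𝓘(ℝ, E).prod 𝓘(ℝ, E))
      (fun x => (⟨x, chartField q (fun z => P z b) x⟩ : TangentBundle 𝓘(ℝ, E) N)) q := fun b =>
    mdifferentiableAt_chartField hx (hPb b)
  have hval : ∀ b, P (extChartAt 𝓘(ℝ, E) q q) b = b →
      chartField q (fun z => P z b) q = chartField q (fun _ => b) q := fun b hb =>
    chartField_congr hb
  have hskew : ∀ v w : TangentSpace 𝓘(ℝ, E) q, ⟪v, J q w⟫ = -⟪w, J q v⟫ := by
    intro v w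
    rw [← hJ.orthogonal q v (J q w), hJ.sq, inner_neg_right, real_inner_comm]
  have hform : ∀ b c, P (extChartAt 𝓘(ℝ, E) q q) b = b →
      ⟪nabla (chartField q fun z => P z b) q (chartField q (fun _ => a) q),
        J q (chartField q (fun _ => c) q)⟫
      = secondForm (metricForm q) P (extChartAt 𝓘(ℝ, E) q q) a b
        (toChart q q (J q (chartField q (fun _ => c) q))) := by
    intro b c hb
    rw [secondForm, ← fderiv_clm_apply_const (hP.differentiableAt (by simp)),
      ← chartField_toChart hx (J q (chartField q (fun _ => c) q)),
      hLC.inner_chartField hx (hPb b), hb, chartField_toChart hx]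
  -- With `∇J = 0`, the hypothesis reads `⟨∇_a b, Jc⟩ + ⟨b, J∇_a c⟩ = 0`; skewness of `J` turns the
  -- second term into `-⟨∇_a c, Jb⟩`.
  rw [hLC.mvfderiv_inner (hd b) (hJ.mdifferentiableAt_apply (hd c)), hpar _ q (hd c), hval c hc, hval b hb,
    hskew (chartField q (fun _ => b) q), hform b c hb, hform c b hc] at h0
  linarith

end Connection

/-- Pythagoras, with `cos ω ‖v‖ = ‖y‖`. For `y = 0` the convention `ω = π / 2` gives the right
value, so Clairaut's integral is polynomial in the velocity without exceptions. -/
theorem sin_angle_sq_mul {V : Type*} [NormedAddCommGroup V] [InnerProductSpace ℝ V] {x y v : V}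
    (hv : v = x + y) (hxy : ⟪x, y⟫ = 0) :
    Real.sin (InnerProductGeometry.angle v y) ^ 2 * ⟪v, v⟫ = ⟪x, x⟫ := by
  have hvv : ⟪v, v⟫ = ⟪x, x⟫ + ⟪y, y⟫ := by
    rw [hv, inner_add_left, inner_add_right, inner_add_right, real_inner_comm x y, hxy]
    ring
  by_cases hy : y = 0
  · rw [hvv, hy, InnerProductGeometry.angle_zero_right]
    simp
  · have hvy : ⟪v, y⟫ = ⟪y, y⟫ := by rw [hv, inner_add_left, hxy, zero_add]
    have h1 := InnerProductGeometry.cos_angle_mul_norm_mul_norm v y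
    rw [hvy, real_inner_self_eq_norm_sq] at h1
    have hy' : ‖y‖ ≠ 0 := norm_ne_zero_iff.2 hy
    have h2 : Real.cos (InnerProductGeometry.angle v y) * ‖v‖ = ‖y‖ := by
      apply mul_right_cancel₀ hy'
      linear_combination h1
    simp only [real_inner_self_eq_norm_sq] at hvv ⊢
    rw [Real.sin_sq]
    linear_combination hvv - (Real.cos (InnerProductGeometry.angle v y) * ‖v‖ + ‖y‖) * h2

/-! ### The orthogonal projection onto a smooth distribution, in a chart. -/

section Projection

variable {E : Type*} [NormedAddCommGroup E] [NormedSpace ℝ E] [FiniteDimensional ℝ E]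
  {N : Type*} [TopologicalSpace N] [ChartedSpace E N] [IsManifold 𝓘(ℝ, E) ∞ N]
  [RiemannianBundle (fun x : N => TangentSpace 𝓘(ℝ, E) x)]
  {D : ∀ q : N, Submodule ℝ (TangentSpace 𝓘(ℝ, E) q)} {q : N} {z : E} {p : E →L[ℝ] E}

/-- `p` is, in the chart around `q` and at the point with coordinates `z`, the orthogonal projection
onto `D`. -/
def IsChartProjection (D : ∀ q : N, Submodule ℝ (TangentSpace 𝓘(ℝ, E) q)) (q : N) (z : E)
    (p : E →L[ℝ] E) : Prop :=
  ∀ a, ofChart q z (p a) ∈ D ((extChartAt 𝓘(ℝ, E) q).symm z) ∧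
    ofChart q z (a - p a) ∈ (D ((extChartAt 𝓘(ℝ, E) q).symm z))ᗮ

theorem IsChartProjection.metricForm_eq_zero (h : IsChartProjection D q z p) (a b : E) :
    metricForm q z (p a) (b - p b) = 0 :=
  (Submodule.mem_orthogonal _ _).1 (h b).2 _ (h a).1

/-- The difference `a - p a` represents a vector of both `D` and `Dᗮ`, hence is zero. -/
theorem IsChartProjection.apply_eq (h : IsChartProjection D q z p)
    (hz : z ∈ (extChartAt 𝓘(ℝ, E) q).target) {a : E}
    (ha : ofChart q z a ∈ D ((extChartAt 𝓘(ℝ, E) q).symm z)) : p a = a := by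
  have h1 : ofChart q z (a - p a) ∈ D ((extChartAt 𝓘(ℝ, E) q).symm z) := by
    rw [map_sub]
    exact Submodule.sub_mem _ ha (h a).1
  have h2 : metricForm q z (a - p a) (a - p a) = 0 :=
    (Submodule.mem_orthogonal _ _).1 (h a).2 _ h1
  by_contra hne
  exact (metricForm_pos hz (sub_ne_zero.2 (Ne.symm hne))).ne' h2

theorem IsChartProjection.idem (h : IsChartProjection D q z p)
    (hz : z ∈ (extChartAt 𝓘(ℝ, E) q).target) (a : E) : p (p a) = p a :=
  h.apply_eq hz (h a).1

theorem IsChartProjection.symm (h : IsChartProjection D q z p) (a b : E) :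
    metricForm q z (p a) b = metricForm q z a (p b) := by
  have h1 := h.metricForm_eq_zero a b
  have h2 := h.metricForm_eq_zero b a
  rw [metricForm_symm, map_sub, _root_.sub_apply] at h2
  rw [map_sub] at h1
  linarith

theorem IsChartProjection.apply_toChart {x : N}
    (h : IsChartProjection D q (extChartAt 𝓘(ℝ, E) q x) p)
    (hx : x ∈ (extChartAt 𝓘(ℝ, E) q).source) {v : TangentSpace 𝓘(ℝ, E) x} (hv : v ∈ D x) :
    p (toChart q x v) = toChart q x v := by
  obtain ⟨z, hz, rfl⟩ : ∃ z ∈ (extChartAt 𝓘(ℝ, E) q).target,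
      (extChartAt 𝓘(ℝ, E) q).symm z = x :=
    ⟨_, (extChartAt 𝓘(ℝ, E) q).map_source hx, (extChartAt 𝓘(ℝ, E) q).left_inv hx⟩
  rw [(extChartAt 𝓘(ℝ, E) q).right_inv hz] at h
  exact h.apply_eq hz (by rwa [ofChart_toChart hz])

theorem IsChartProjection.apply_toChart_eq_zero {x : N}
    (h : IsChartProjection D q (extChartAt 𝓘(ℝ, E) q x) p)
    (hx : x ∈ (extChartAt 𝓘(ℝ, E) q).source) {v : TangentSpace 𝓘(ℝ, E) x} (hv : v ∈ (D x)ᗮ) :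
    p (toChart q x v) = 0 := by
  obtain ⟨z, hz, rfl⟩ : ∃ z ∈ (extChartAt 𝓘(ℝ, E) q).target,
      (extChartAt 𝓘(ℝ, E) q).symm z = x :=
    ⟨_, (extChartAt 𝓘(ℝ, E) q).map_source hx, (extChartAt 𝓘(ℝ, E) q).left_inv hx⟩
  rw [(extChartAt 𝓘(ℝ, E) q).right_inv hz] at h
  set a := toChart q _ v with ha
  have hv' : ofChart q z a ∈ (D ((extChartAt 𝓘(ℝ, E) q).symm z))ᗮ := by
    rwa [ha, ofChart_toChart hz]
  have h1 : metricForm q z (p a) a = 0 := (Submodule.mem_orthogonal _ _).1 hv' _ (h a).1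
  have h2 := h.metricForm_eq_zero a a
  rw [map_sub, h1, zero_sub, neg_eq_zero] at h2
  by_contra hne
  exact (metricForm_pos hz hne).ne' h2

theorem IsChartProjection.chartField_mem {x : N}
    (h : IsChartProjection D q (extChartAt 𝓘(ℝ, E) q x) p)
    (hx : x ∈ (extChartAt 𝓘(ℝ, E) q).source) {Y : E → E} {a : E}
    (hY : Y (extChartAt 𝓘(ℝ, E) q x) = p a) : chartField q Y x ∈ D x := by
  obtain ⟨z, hz, rfl⟩ : ∃ z ∈ (extChartAt 𝓘(ℝ, E) q).target,
      (extChartAt 𝓘(ℝ, E) q).symm z = x :=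
    ⟨_, (extChartAt 𝓘(ℝ, E) q).map_source hx, (extChartAt 𝓘(ℝ, E) q).left_inv hx⟩
  rw [(extChartAt 𝓘(ℝ, E) q).right_inv hz] at h hY
  rw [chartField_symm hz, hY]
  exact (h a).1

/-- A smooth distribution has a smooth orthogonal projection in charts. -/
theorem IsSmoothDistributionOn.exists_chartProjection
    [IsContMDiffRiemannianBundle 𝓘(ℝ, E) ∞ E (fun x : N => TangentSpace 𝓘(ℝ, E) x)]
    {k : ℕ} {W : Set N} (hD : IsSmoothDistributionOn D k W) (hq : q ∈ W) :
    ∃ P : E → E →L[ℝ] E, ContDiffAt ℝ ∞ P (extChartAt 𝓘(ℝ, E) q q) ∧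
      ∀ᶠ z in 𝓝 (extChartAt 𝓘(ℝ, E) q q), IsChartProjection D q z (P z) := by
  obtain ⟨U, hU, σ, hσ, hspan⟩ := hD q hq
  have hsrc := mem_extChartAt_source (I := 𝓘(ℝ, E)) q
  have htgt : ∀ᶠ z in 𝓝 (extChartAt 𝓘(ℝ, E) q q), z ∈ (extChartAt 𝓘(ℝ, E) q).target :=
    (isOpen_extChartAt_target q).mem_nhds (mem_extChartAt_target q)
  have hcont : Tendsto (extChartAt 𝓘(ℝ, E) q).symm (𝓝 (extChartAt 𝓘(ℝ, E) q q)) (𝓝 q) := by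
    have h := (continuousAt_extChartAt_symm (I := 𝓘(ℝ, E)) q).tendsto
    rwa [extChartAt_to_inv] at h
  have hUz := hcont.eventually hU
  let τ : Fin k → E → E := fun i z => toChart q ((extChartAt 𝓘(ℝ, E) q).symm z)
    (σ i ((extChartAt 𝓘(ℝ, E) q).symm z))
  have hlin : ∀ᶠ z in 𝓝 (extChartAt 𝓘(ℝ, E) q q), LinearIndependent ℝ (fun i => τ i z) := by
    filter_upwards [htgt, hUz] with z hz hzU
    exact (hspan _ hzU).1.map' (toChart q _).toLinearMap (LinearMap.ker_eq_bot.2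
      (isInvertible_toChart ((extChartAt 𝓘(ℝ, E) q).map_target hz)).injective)
  obtain ⟨P, hP, hPz⟩ := exists_orthogonal_projection
    (contDiffOn_metricForm.contDiffAt htgt)
    (htgt.mono fun z hz a ha => metricForm_pos hz ha)
    (σ := τ) (fun i => contDiffAt_toChart hsrc ((hσ i).contMDiffAt hU)) hlin
  refine ⟨P, hP, ?_⟩
  filter_upwards [htgt, hUz, hPz] with z hz hzU hz' a
  have hτ : ∀ i, ofChart q z (τ i z) = σ i ((extChartAt 𝓘(ℝ, E) q).symm z) := fun i =>
    ofChart_toChart hz _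
  rw [← (hspan _ hzU).2]
  constructor
  · have hle : Submodule.span ℝ (range fun i => τ i z) ≤
        (Submodule.span ℝ (range fun i => σ i ((extChartAt 𝓘(ℝ, E) q).symm z))).comap
          (ofChart q z).toLinearMap := by
      rw [Submodule.span_le]
      rintro _ ⟨i, rfl⟩
      exact Submodule.subset_span ⟨i, (hτ i).symm⟩
    exact hle (hz' a).1
  · have hle : Submodule.span ℝ (range fun i => σ i ((extChartAt 𝓘(ℝ, E) q).symm z)) ≤
        (Submodule.span ℝ {ofChart q z (a - P z a)})ᗮ := by
      rw [Submodule.span_le]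
      rintro _ ⟨i, rfl⟩
      rw [SetLike.mem_coe, Submodule.mem_orthogonal_singleton_iff_inner_left]
      beta_reduce
      rw [← hτ i]
      exact (hz' a).2 i
    rw [Submodule.mem_orthogonal]
    intro v hv
    exact Submodule.mem_orthogonal_singleton_iff_inner_left.1 (hle hv)

end Projection

/-! ### Clairaut's relation along the geodesics through a point. -/

section FirstIntegral

variable {E : Type*} [NormedAddCommGroup E] [NormedSpace ℝ E] [FiniteDimensional ℝ E]
  {N : Type*} [TopologicalSpace N] [ChartedSpace E N] [IsManifold 𝓘(ℝ, E) ∞ N]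
  [RiemannianBundle (fun x : N => TangentSpace 𝓘(ℝ, E) x)]
  [IsContMDiffRiemannianBundle 𝓘(ℝ, E) ∞ E (fun x : N => TangentSpace 𝓘(ℝ, E) x)]
  {D : ∀ q : N, Submodule ℝ (TangentSpace 𝓘(ℝ, E) q)} {q : N}

theorem velocity_symm_comp {u : ℝ → E} {w : E} {t : ℝ} (hu : HasDerivAt u w t)
    (ht : u t ∈ (extChartAt 𝓘(ℝ, E) q).target) :
    velocity (fun τ => (extChartAt 𝓘(ℝ, E) q).symm (u τ)) t = ofChart q (u t) w := by
  have h1 : MDifferentiableAt 𝓘(ℝ, E) 𝓘(ℝ, E) (extChartAt 𝓘(ℝ, E) q).symm (u t) :=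
    ((contMDiffOn_extChartAt_symm (n := ∞) q).contMDiffAt
      ((isOpen_extChartAt_target q).mem_nhds ht)).mdifferentiableAt (by simp)
  have h2 := h1.hasMFDerivAt.comp t hu.hasFDerivAt.hasMFDerivAt
  have h3 := DFunLike.congr_fun h2.mfderiv (1 : ℝ)
  refine h3.trans ?_
  have h4 : (ContinuousLinearMap.toSpanSingleton ℝ w) (1 : ℝ) = w := by simp
  exact congrArg (ofChart q (u t)) h4

/-- A curve that solves the geodesic equation in a chart is a geodesic. -/
theorem isGeodesicOn_of_chart {ε : ℝ} {u w : ℝ → E} (hu2 : ContDiffOn ℝ 2 u (Ioo (-ε) ε))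
    (hu : ∀ t ∈ Ioo (-ε) ε, u t ∈ (extChartAt 𝓘(ℝ, E) q).target ∧ HasDerivAt u (w t) t ∧
      HasDerivAt w (acceleration (metricForm q) (u t, w t)) t) :
    IsGeodesicOn (E := E) (fun t => (extChartAt 𝓘(ℝ, E) q).symm (u t)) (Ioo (-ε) ε) := by
  refine ⟨?_, fun t ht => ⟨q, ?_⟩⟩
  · exact ((contMDiffOn_extChartAt_symm (n := 2) q)).comp hu2.contMDiffOn fun t ht => (hu t ht).1
  · filter_upwards [isOpen_Ioo.mem_nhds ht] with s hs
    refine ⟨?_, fun c => ?_⟩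
    · have := (extChartAt 𝓘(ℝ, E) q).map_target (hu s hs).1
      simpa using this
    · have hev : ∀ τ ∈ Ioo (-ε) ε,
          (fun τ => extChartAt 𝓘(ℝ, E) q ((extChartAt 𝓘(ℝ, E) q).symm (u τ))) =ᶠ[𝓝 τ] u := by
        intro τ hτ
        filter_upwards [isOpen_Ioo.mem_nhds hτ] with r hr
        exact (extChartAt 𝓘(ℝ, E) q).right_inv (hu r hr).1
      have hd : deriv (fun τ => extChartAt 𝓘(ℝ, E) q ((extChartAt 𝓘(ℝ, E) q).symm (u τ)))
          =ᶠ[𝓝 s] w := by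
        filter_upwards [isOpen_Ioo.mem_nhds hs] with r hr
        rw [(hev r hr).deriv_eq, (hu r hr).2.1.deriv]
      intro v
      have e0 : v s = u s := (hev s hs).self_of_nhds
      have e1 : deriv v s = w s := hd.self_of_nhds
      have e2 : deriv (deriv v) s = acceleration (metricForm q) (u s, w s) := by
        rw [hd.deriv_eq, (hu s hs).2.2.deriv]
      rw [e0, e1, e2, christoffelFirst_eq]
      exact acceleration_spec (differentiableAt_metricForm (hu s hs).1)
        (fun a ha => metricForm_pos (hu s hs).1 ha) _ _

/-- Clairaut's relation, differentiated along the geodesics through `q`. -/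
theorem ClairautRelation.firstIntegral {W : Set N} {g : N → ℝ}
    (hC : ClairautRelation D W fun x => Real.exp (g x)) (hW : IsOpen W) (hq : q ∈ W)
    (hg : ContMDiff 𝓘(ℝ, E) 𝓘(ℝ, ℝ) ∞ g) {P : E → E →L[ℝ] E}
    (hP : ContDiffAt ℝ ∞ P (extChartAt 𝓘(ℝ, E) q q))
    (hPz : ∀ᶠ z in 𝓝 (extChartAt 𝓘(ℝ, E) q q), IsChartProjection D q z (P z)) (v : E) :
    2 * fderiv ℝ (fun z => g ((extChartAt 𝓘(ℝ, E) q).symm z)) (extChartAt 𝓘(ℝ, E) q q) v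
        * metricForm q (extChartAt 𝓘(ℝ, E) q q) (P (extChartAt 𝓘(ℝ, E) q q) v) v
      + metricDeriv (metricForm q) (extChartAt 𝓘(ℝ, E) q q) v (P (extChartAt 𝓘(ℝ, E) q q) v) v
      + metricForm q (extChartAt 𝓘(ℝ, E) q q) (fderiv ℝ P (extChartAt 𝓘(ℝ, E) q q) v v) v
      - 2 * christoffel (metricForm q) (extChartAt 𝓘(ℝ, E) q q) v v
        (P (extChartAt 𝓘(ℝ, E) q q) v) = 0 := by
  have htgt : ∀ᶠ z in 𝓝 (extChartAt 𝓘(ℝ, E) q q), z ∈ (extChartAt 𝓘(ℝ, E) q).target :=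
    (isOpen_extChartAt_target q).mem_nhds (mem_extChartAt_target q)
  have hcont : Tendsto (extChartAt 𝓘(ℝ, E) q).symm (𝓝 (extChartAt 𝓘(ℝ, E) q q)) (𝓝 q) := by
    have h := (continuousAt_extChartAt_symm (I := 𝓘(ℝ, E)) q).tendsto
    rwa [extChartAt_to_inv] at h
  obtain ⟨Ω, hΩ, hΩo, hyΩ⟩ := eventually_nhds_iff.1
    ((htgt.and (hcont.eventually (hW.mem_nhds hq))).and hPz)
  have hG : ContDiffOn ℝ ∞ (metricForm q) Ω := contDiffOn_metricForm.mono fun z hz => (hΩ z hz).1.1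
  obtain ⟨ε, hε, u, w, hu0, hw0, hu2, hu⟩ := exists_geodesic hΩo hG
    (fun z hz a ha => metricForm_pos (hΩ z hz).1.1 ha) hyΩ v
  have hut : ∀ t ∈ Ioo (-ε) ε, u t ∈ (extChartAt 𝓘(ℝ, E) q).target := fun t ht =>
    (hΩ _ (hu t ht).1).1.1
  have hgeo := isGeodesicOn_of_chart hu2 fun t ht => ⟨hut t ht, (hu t ht).2⟩
  have hvel : ∀ t ∈ Ioo (-ε) ε, velocity (fun τ => (extChartAt 𝓘(ℝ, E) q).symm (u τ)) t
      = ofChart q (u t) (w t) := fun t ht => velocity_symm_comp (hu t ht).2.1 (hut t ht)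
  obtain ⟨c, hc⟩ := hC (-ε) ε _ (fun t ht => (hΩ _ (hu t ht).1).1.2) hgeo
    (fun t => ofChart q (u t) (P (u t) (w t))) (fun t => ofChart q (u t) (w t - P (u t) (w t)))
    (fun t ht => ⟨((hΩ _ (hu t ht).1).2 _).1, ((hΩ _ (hu t ht).1).2 _).2, by
      rw [hvel t ht, ← map_add, add_sub_cancel]⟩)
  have h0 : (0 : ℝ) ∈ Ioo (-ε) ε := ⟨by linarith, hε⟩
  have hgs : DifferentiableAt ℝ (fun z => g ((extChartAt 𝓘(ℝ, E) q).symm z))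
      (extChartAt 𝓘(ℝ, E) q q) := by
    have h2 := (contMDiffOn_extChartAt_symm (I := 𝓘(ℝ, E)) (n := ∞) q).contMDiffAt htgt
    exact ((hg.contMDiffAt.comp _ h2).contDiffAt).differentiableAt (by simp)
  have key := hPz.self_of_nhds
  refine clairaut_deriv (differentiableAt_metricForm htgt.self_of_nhds)
    (hP.differentiableAt (by simp)) hgs (fun b c => key.symm b c)
    (fun b c => metricForm_symm _ b c) hu0 hw0 (hw0 ▸ (hu 0 h0).2.1) (hu 0 h0).2.2 ?_
    (C := c ^ 2) ?_
  · intro b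
    rw [hu0, hw0]
    exact acceleration_spec (differentiableAt_metricForm htgt.self_of_nhds)
      (fun a ha => metricForm_pos htgt.self_of_nhds ha) _ _
  -- Squaring the relation and multiplying by `|β'|²` replaces the sine by `⟨Pβ', β'⟩`; hence the
  -- constant `c ^ 2`.
  · filter_upwards [isOpen_Ioo.mem_nhds h0] with t ht
    have hpr := (hΩ _ (hu t ht).1).2
    have hsin := sin_angle_sq_mul (v := ofChart q (u t) (w t))
      (x := ofChart q (u t) (P (u t) (w t))) (y := ofChart q (u t) (w t - P (u t) (w t)))
      (by rw [← map_add, add_sub_cancel]) (hpr.metricForm_eq_zero _ _)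
    have hct := hc t ht
    rw [hvel t ht] at hct
    have hPP : metricForm q (u t) (P (u t) (w t)) (w t)
        = metricForm q (u t) (P (u t) (w t)) (P (u t) (w t)) := by
      rw [← sub_eq_zero, ← map_sub]
      exact hpr.metricForm_eq_zero _ _
    rw [← hct, hPP, metricForm_apply, ← hsin, metricForm_apply, two_mul, Real.exp_add]
    ring

end FirstIntegral

/-! ### The map `F` in charts, and derivatives along it. -/

section Maps

variable {E₁ : Type*} [NormedAddCommGroup E₁] [NormedSpace ℝ E₁]
  {M : Type*} [TopologicalSpace M] [ChartedSpace E₁ M] [IsManifold 𝓘(ℝ, E₁) ∞ M]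
  {E₂ : Type*} [NormedAddCommGroup E₂] [NormedSpace ℝ E₂]
  {N : Type*} [TopologicalSpace N] [ChartedSpace E₂ N] [IsManifold 𝓘(ℝ, E₂) ∞ N]
  {F : M → N} {p : M} {q : N}

theorem contDiffAt_inCharts (hF : ContMDiff 𝓘(ℝ, E₁) 𝓘(ℝ, E₂) ∞ F) {x : M}
    (hx : x ∈ (extChartAt 𝓘(ℝ, E₁) p).source) (hFx : F x ∈ (extChartAt 𝓘(ℝ, E₂) q).source) :
    ContDiffAt ℝ ∞ (fun m => extChartAt 𝓘(ℝ, E₂) q (F ((extChartAt 𝓘(ℝ, E₁) p).symm m)))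
      (extChartAt 𝓘(ℝ, E₁) p x) := by
  have h1 : ContMDiffAt 𝓘(ℝ, E₁) 𝓘(ℝ, E₁) ∞ (extChartAt 𝓘(ℝ, E₁) p).symm
      (extChartAt 𝓘(ℝ, E₁) p x) :=
    (contMDiffOn_extChartAt_symm p).contMDiffAt
      ((isOpen_extChartAt_target p).mem_nhds ((extChartAt 𝓘(ℝ, E₁) p).map_source hx))
  have h2 : ContMDiffAt 𝓘(ℝ, E₂) 𝓘(ℝ, E₂) ∞ (extChartAt 𝓘(ℝ, E₂) q) (F x) :=
    contMDiffAt_extChartAt' (by simpa using hFx)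
  exact (ContMDiffAt.comp_of_eq (h2.comp x hF.contMDiffAt) h1
    ((extChartAt 𝓘(ℝ, E₁) p).left_inv hx)).contDiffAt

theorem fderiv_inCharts (hF : ContMDiff 𝓘(ℝ, E₁) 𝓘(ℝ, E₂) ∞ F) {x : M}
    (hx : x ∈ (extChartAt 𝓘(ℝ, E₁) p).source) (hFx : F x ∈ (extChartAt 𝓘(ℝ, E₂) q).source)
    (v : TangentSpace 𝓘(ℝ, E₁) x) :
    fderiv ℝ (fun m => extChartAt 𝓘(ℝ, E₂) q (F ((extChartAt 𝓘(ℝ, E₁) p).symm m)))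
      (extChartAt 𝓘(ℝ, E₁) p x) (toChart p x v) = toChart q (F x) (diff (E₂ := E₂) F x v) := by
  obtain ⟨z, hz, rfl⟩ : ∃ z ∈ (extChartAt 𝓘(ℝ, E₁) p).target,
      (extChartAt 𝓘(ℝ, E₁) p).symm z = x :=
    ⟨_, (extChartAt 𝓘(ℝ, E₁) p).map_source hx, (extChartAt 𝓘(ℝ, E₁) p).left_inv hx⟩
  have h1 : MDifferentiableAt 𝓘(ℝ, E₁) 𝓘(ℝ, E₁) (extChartAt 𝓘(ℝ, E₁) p).symm z :=
    ((contMDiffOn_extChartAt_symm (n := ∞) p).contMDiffAt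
      ((isOpen_extChartAt_target p).mem_nhds hz)).mdifferentiableAt (by simp)
  have h2 : MDifferentiableAt 𝓘(ℝ, E₁) 𝓘(ℝ, E₂) F ((extChartAt 𝓘(ℝ, E₁) p).symm z) :=
    hF.contMDiffAt.mdifferentiableAt (by simp)
  have h3 := mdifferentiableAt_extChartAt (I := 𝓘(ℝ, E₂)) (x := q) (by simpa using hFx)
  have h := (HasMFDerivAt.comp z (f := F ∘ (extChartAt 𝓘(ℝ, E₁) p).symm) h3.hasMFDerivAt
    (HasMFDerivAt.comp z h2.hasMFDerivAt h1.hasMFDerivAt)).mfderiv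
  rw [(extChartAt 𝓘(ℝ, E₁) p).right_inv hz, ← mfderiv_eq_fderiv]
  let a : E₁ := toChart p _ v
  refine (DFunLike.congr_fun h a).trans ?_
  exact congrArg (fun a => toChart q _ (diff (E₂ := E₂) F _ a)) (ofChart_toChart hz v)

/-- This serves for functions that vanish on the image of `F` near `F p` but perhaps not on a
neighbourhood in `N`. -/
theorem mvfderiv_diff_eq_zero {h : N → ℝ} (hh : MDifferentiableAt 𝓘(ℝ, E₂) 𝓘(ℝ, ℝ) h (F p))
    (hF : MDifferentiableAt 𝓘(ℝ, E₁) 𝓘(ℝ, E₂) F p) (h0 : ∀ᶠ x in 𝓝 p, h (F x) = 0)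
    (v : TangentSpace 𝓘(ℝ, E₁) p) : mvfderiv 𝓘(ℝ, E₂) h (F p) (diff (E₂ := E₂) F p v) = 0 := by
  have h1 := (hh.hasMFDerivAt.comp p hF.hasMFDerivAt).mfderiv
  have h2 : h ∘ F =ᶠ[𝓝 p] fun _ => (0 : ℝ) := h0
  rw [h2.mfderiv_eq, mfderiv_const] at h1
  exact (DFunLike.congr_fun h1 v).symm

end Maps

/-! ### The pointwise conclusion in rank at least two. -/

section Rigidity

variable {E₁ : Type*} [NormedAddCommGroup E₁] [NormedSpace ℝ E₁]
  {M : Type*} [TopologicalSpace M] [ChartedSpace E₁ M] [IsManifold 𝓘(ℝ, E₁) ∞ M]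
  {E₂ : Type*} [NormedAddCommGroup E₂] [NormedSpace ℝ E₂] [FiniteDimensional ℝ E₂]
  {N : Type*} [TopologicalSpace N] [ChartedSpace E₂ N] [IsManifold 𝓘(ℝ, E₂) ∞ N]
  [RiemannianBundle (fun x : N => TangentSpace 𝓘(ℝ, E₂) x)]
  [IsContMDiffRiemannianBundle 𝓘(ℝ, E₂) ∞ E₂ (fun x : N => TangentSpace 𝓘(ℝ, E₂) x)]

/-- At a point where the rank is at least two, `g` is critical along `J (range F_*)`. -/
theorem mvfderiv_eq_zero_of_clairaut
    {J : ∀ q : N, TangentSpace 𝓘(ℝ, E₂) q →L[ℝ] TangentSpace 𝓘(ℝ, E₂) q} (hJ : IsKahler J)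
    {F : M → N} (hF : ContMDiff 𝓘(ℝ, E₁) 𝓘(ℝ, E₂) ∞ F) (hanti : IsAntiInvariant (E₁ := E₁) J F)
    {g : N → ℝ} (hg : ContMDiff 𝓘(ℝ, E₂) 𝓘(ℝ, ℝ) ∞ g)
    (hC : IsClairaut (E₁ := E₁) (E₂ := E₂) F (fun q => Real.exp (g q))) {p : M}
    (hrank : 1 < Module.finrank ℝ (rangeDiff (E₁ := E₁) (E₂ := E₂) F p)) :
    ∀ v ∈ rangeDiff (E₁ := E₁) (E₂ := E₂) F p,
      mvfderiv 𝓘(ℝ, E₂) g (F p) (J (F p) v) = 0 := by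
  have : CompleteSpace E₂ := FiniteDimensional.complete ℝ E₂
  obtain ⟨U, W, k, D, hU, hpU, hW, hUW, hD, hDF, hrel⟩ := hC p
  have hqW : F p ∈ W := hUW hpU
  obtain ⟨P, hP, hPz⟩ := hD.exists_chartProjection hqW
  have hint := hrel.firstIntegral hW hqW hg hP hPz
  set q := F p with hq
  set y := extChartAt 𝓘(ℝ, E₂) q q with hy
  have hps := mem_extChartAt_source (I := 𝓘(ℝ, E₁)) p
  have hqs := mem_extChartAt_source (I := 𝓘(ℝ, E₂)) q
  have htgt : ∀ᶠ z in 𝓝 y, z ∈ (extChartAt 𝓘(ℝ, E₂) q).target :=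
    (isOpen_extChartAt_target q).mem_nhds (mem_extChartAt_target q)
  have hPy := hPz.self_of_nhds
  have hG := differentiableAt_metricForm htgt.self_of_nhds
  have hnear : ∀ᶠ x in 𝓝 p, x ∈ U ∧ F x ∈ (extChartAt 𝓘(ℝ, E₂) q).source ∧
      IsChartProjection D q (extChartAt 𝓘(ℝ, E₂) q (F x)) (P (extChartAt 𝓘(ℝ, E₂) q (F x))) := by
    have hFc : Tendsto F (𝓝 p) (𝓝 q) := hF.continuous.continuousAt
    have hφ : Tendsto (extChartAt 𝓘(ℝ, E₂) q) (𝓝 q) (𝓝 y) := continuousAt_extChartAt q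
    filter_upwards [hU.mem_nhds hpU, hFc.eventually (extChartAt_source_mem_nhds (I := 𝓘(ℝ, E₂)) q),
      (hφ.comp hFc).eventually hPz] with x h1 h2 h3
    exact ⟨h1, h2, h3⟩
  set f : E₁ → E₂ := fun m => extChartAt 𝓘(ℝ, E₂) q (F ((extChartAt 𝓘(ℝ, E₁) p).symm m)) with hf
  set m := extChartAt 𝓘(ℝ, E₁) p p with hm
  have hfm : f m = y := by simp [hf, hm, hy, hq]
  have hfsmooth : ContDiffAt ℝ ∞ f m := contDiffAt_inCharts hF hps hqs
  -- `D` equals `range F_*` at `F x` for all `x` near `p`, so this identity may be differentiated at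
  -- `m`.
  have hproj : ∀ᶠ z in 𝓝 m, ∀ b, P (f z) (fderiv ℝ f z b) = fderiv ℝ f z b := by
    have hψ : Tendsto (extChartAt 𝓘(ℝ, E₁) p).symm (𝓝 m) (𝓝 p) := by
      have h := (continuousAt_extChartAt_symm (I := 𝓘(ℝ, E₁)) p).tendsto
      rwa [extChartAt_to_inv] at h
    filter_upwards [(isOpen_extChartAt_target (I := 𝓘(ℝ, E₁)) p).mem_nhds
      (mem_extChartAt_target p), hψ.eventually hnear] with z hz ⟨hzU, hzs, hzP⟩ b
    have h := fderiv_inCharts hF (p := p) (q := q) ((extChartAt 𝓘(ℝ, E₁) p).map_target hz) hzs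
      (ofChart p z b)
    rw [toChart_ofChart hz, (extChartAt 𝓘(ℝ, E₁) p).right_inv hz] at h
    rw [h]
    refine hzP.apply_toChart hzs ?_
    rw [hDF _ hzU]
    exact ⟨_, rfl⟩
  let R : Submodule ℝ E₂ :=
    (rangeDiff (E₁ := E₁) (E₂ := E₂) F p).map (toChart q q).toLinearMap
  have hR : 1 < Module.finrank ℝ R := by
    rwa [← (Submodule.equivMapOfInjective (toChart q q).toLinearMap
      (isInvertible_toChart hqs).injective (rangeDiff (E₁ := E₁) (E₂ := E₂) F p)).finrank_eq]
  have hRP : ∀ x ∈ R, P y x = x := by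
    rintro _ ⟨u, hu, rfl⟩
    exact hPy.apply_toChart hqs (by rw [hDF p hpU]; exact hu)
  have hRf : ∀ x ∈ R, ∃ a, fderiv ℝ f m a = x := by
    rintro _ ⟨_, ⟨u, rfl⟩, rfl⟩
    exact ⟨toChart p p u, fderiv_inCharts hF hps hqs u⟩
  have hRfield : ∀ x ∈ R, chartField q (fun _ => x) q ∈ rangeDiff (E₁ := E₁) (E₂ := E₂) F p := by
    rintro _ ⟨u, hu, rfl⟩
    have h := chartField_toChart hqs u
    exact h.symm ▸ hu
  let j : E₂ → E₂ := fun c => toChart q q (J q (chartField q (fun _ => c) q))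
  have hj : ∀ c ∈ R, P y (j c) = 0 := fun c hc => by
    refine hPy.apply_toChart_eq_zero hqs ?_
    rw [hDF p hpU]
    exact hanti p _ (hRfield c hc)
  have hsymm : ∀ x ∈ R, ∀ b ∈ R, ∀ w, secondForm (metricForm q) P y x b w
      = secondForm (metricForm q) P y b x w := by
    intro x hx b hb w
    obtain ⟨a, rfl⟩ := hRf x hx
    obtain ⟨a', rfl⟩ := hRf b hb
    have h := fderiv_projection_symm (hfsmooth.of_le (by norm_cast))
      (hfm.symm ▸ hP.differentiableAt (by simp)) hproj a a'
    rw [hfm] at h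
    rw [secondForm, secondForm, h, christoffel_metricForm_symm]
  have hkahler : ∀ x ∈ R, ∀ b ∈ R, ∀ c ∈ R, secondForm (metricForm q) P y x b (j c)
      = secondForm (metricForm q) P y x c (j b) := by
    intro x hx b hb c hc
    refine hJ.secondForm_symm hP (hRP b hb) (hRP c hc) ?_
    -- The direction is `F_* u`, so `⟨Pb, JPc⟩` is needed only at points `F x`; there both projected
    -- fields lie in `range F_*` and anti-invariance makes it zero.
    obtain ⟨u, hu⟩ := hRfield x hx
    rw [← hu]
    have hd : ∀ b, MDifferentiableAt 𝓘(ℝ, E₂) (𝓘(ℝ, E₂).prod 𝓘(ℝ, E₂))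
        (fun x => (⟨x, chartField q (fun z => P z b) x⟩ : TangentBundle 𝓘(ℝ, E₂) N)) q :=
      fun b => mdifferentiableAt_chartField hqs (hP.clm_apply contDiffAt_const)
    refine mvfderiv_diff_eq_zero (MDifferentiableAt.inner_bundle (F := E₂)
      (E := fun x : N => TangentSpace 𝓘(ℝ, E₂) x) (hd b) (hJ.mdifferentiableAt_apply (hd c)))
      (hF.contMDiffAt.mdifferentiableAt (by simp)) ?_ u
    filter_upwards [hnear] with x ⟨hxU, hxs, hxP⟩
    have hmem : ∀ b, chartField q (fun z => P z b) (F x)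
        ∈ rangeDiff (E₁ := E₁) (E₂ := E₂) F x := fun b => by
      rw [← hDF x hxU]
      exact hxP.chartField_mem hxs rfl
    exact (Submodule.mem_orthogonal _ _).1 (hanti x _ (hmem c)) _ (hmem b)
  have humb : ∀ x ∈ R, ∀ c ∈ R,
      fderiv ℝ (fun z => g ((extChartAt 𝓘(ℝ, E₂) q).symm z)) y (j c) * metricForm q y x x
        + secondForm (metricForm q) P y x x (j c) = 0 := fun x hx c hc =>
    umbilic_of_firstIntegral hG (hP.differentiableAt (by simp))
      (Eventually.of_forall fun z => metricForm_symm z)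
      (by filter_upwards [htgt, hPz] with z hz hz' using hz'.idem hz)
      (hPz.mono fun z hz => hz.symm) hint (hRP x hx) (hj c hc)
  intro v hv
  have hfin := mean_curvature_eq_zero hG (fun a ha => metricForm_pos htgt.self_of_nhds ha)
    (metricForm_symm y) hR humb hsymm hkahler (z := toChart q q v) ⟨v, hv, rfl⟩
  have hgs : DifferentiableAt ℝ (fun z => g ((extChartAt 𝓘(ℝ, E₂) q).symm z)) y := by
    have h2 := (contMDiffOn_extChartAt_symm (I := 𝓘(ℝ, E₂)) (n := ∞) q).contMDiffAt htgt
    exact ((hg.contMDiffAt.comp _ h2).contDiffAt).differentiableAt (by simp)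
  refine (mvfderiv_eq_chart hqs hgs ?_ (J q v)).trans ?_
  rotate_left
  · simpa only [j, chartField_toChart hqs] using hfin
  · filter_upwards [(isOpen_extChartAt_source (I := 𝓘(ℝ, E₂)) q).mem_nhds hqs] with x hx
    rw [(extChartAt 𝓘(ℝ, E₂) q).left_inv hx]

end Rigidity

end ClairautMap

end

theorem mainTheorem10
    {E₁ : Type*} [NormedAddCommGroup E₁] [NormedSpace ℝ E₁] [FiniteDimensional ℝ E₁]
    {M : Type*} [TopologicalSpace M] [ChartedSpace E₁ M] [IsManifold 𝓘(ℝ, E₁) ∞ M]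
    [RiemannianBundle (fun x : M => TangentSpace 𝓘(ℝ, E₁) x)]
    [IsContMDiffRiemannianBundle 𝓘(ℝ, E₁) ∞ E₁ (fun x : M => TangentSpace 𝓘(ℝ, E₁) x)]
    {E₂ : Type*} [NormedAddCommGroup E₂] [NormedSpace ℝ E₂] [FiniteDimensional ℝ E₂]
    {N : Type*} [TopologicalSpace N] [ChartedSpace E₂ N] [IsManifold 𝓘(ℝ, E₂) ∞ N]
    [RiemannianBundle (fun x : N => TangentSpace 𝓘(ℝ, E₂) x)]
    [IsContMDiffRiemannianBundle 𝓘(ℝ, E₂) ∞ E₂ (fun x : N => TangentSpace 𝓘(ℝ, E₂) x)]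
    (J : ∀ q : N, TangentSpace 𝓘(ℝ, E₂) q →L[ℝ] TangentSpace 𝓘(ℝ, E₂) q)
    (hJ : ClairautMap.IsKahler J)
    (F : M → N)
    (hF : ClairautMap.IsRiemannianMap (E₁ := E₁) (E₂ := E₂) F)
    (hanti : ClairautMap.IsAntiInvariant (E₁ := E₁) J F)
    (g : N → ℝ) (hg : ContMDiff 𝓘(ℝ, E₂) 𝓘(ℝ, ℝ) ∞ g)
    (hClairaut : ClairautMap.IsClairaut (E₁ := E₁) (E₂ := E₂) F (fun q => Real.exp (g q))) :
    (∀ p : M, Module.finrank ℝ (ClairautMap.rangeDiff (E₁ := E₁) (E₂ := E₂) F p) = 1) ∨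
    (∀ p : M, ∀ v ∈ ClairautMap.rangeDiff (E₁ := E₁) (E₂ := E₂) F p,
      mvfderiv 𝓘(ℝ, E₂) g (F p) (J (F p) v) = 0) := by
  obtain ⟨k, hk, hrank⟩ := hF.rank
  -- As the rank is constant, a single alternative serves all points at once.
  by_cases h1 : k = 1
  · exact Or.inl fun p => (hrank p).trans h1
  · exact Or.inr fun p => ClairautMap.mvfderiv_eq_zero_of_clairaut hJ hF.smooth hanti hg hClairaut
      (by rw [hrank p]; omega)
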